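/- Let $\mathcal X$ be a measurable space with an arbitrary measure $\mu$, let $M\ge 2$, let $p_1,\dots,p_M$ be arbitrary known probability densities on $\mathcal X$ with respect to $\mu$, let $n\ge 1$ and $\delta\in(0,1)$, and write $\mathrm{KL}(p,q)=\int p\log(p/q)\,d\mu$. There is a density estimator $\widehat p=\widehat p(X_1,\dots,X_n)$, depending only on $p_1,\dots,p_M$, $n$ and $\delta$, such that for every $p^\star\in\{p_1,\dots,p_M\}$, if $X_1,\dots,X_n$ are i.i.d. with density $p^\star$, then with probability at least $1-\delta$, $$\mathrm{KL}(p^\star,\widehat p)\le \min\left\{\frac{75\log(2M)\log(2/\delta)}{n},\ \log M\right\}.$$ The following $\widehat p$ has this property. If $n\le 75\log(2/\delta)$, then $\widehat p=\frac1M\sum_{i=1}^M p_i$. Otherwise put $m=\lfloor n/2\rfloor$. 1. (Almost-MLE set.) With $\widehat L_m(p)=-\frac1m\sum_{k=1}^m\log p(X_k)$, let $W$ be the set of $i\in\{1,\dots,M\}$ such that $\widehat L_m(p_i)-\min_j\widehat L_m(p_j)\le \frac{2\log(4M/\delta)}{m}$, that is, $\prod_{k=1}^m p_j(X_k)\le (4M/\delta)^2\prod_{k=1}^m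 p_i(X_k)$ for all $j$. 2. (Smoothed class.) For $i\in W$ let $q_i=\frac12p_i+\frac1{2|W|}\sum_{j\in W}p_j$. 3. (Progressive mixture rule.) With $Y_k=X_{m+k}$ for $1\le k\le m$, define recursively $\widehat p_t=\sum_{i\in W}\frac{w_{t,i}}{\sum_{h\in W}w_{t,h}}\,q_i$ for $1\le t\le m$, where $w_{t,i}=\prod_{k=1}^{t-1}\left(\tfrac12 q_i(Y_k)+\tfrac12\widehat p_k(Y_k)\right)$ (equal weights if all $w_{t,i}$ vanish, an event of probability $0$ when $i^\star\in W$, where $p^\star=p_{i^\star}$). Then $\widehat p=\frac1m\sum_{t=1}^m\widehat p_t$. The bound is optimal up to a multiplicative constant: there is an absolute constant $c>0$ such that for all $M\ge2$, $n\ge1$ and $\delta\in(0,\frac12]$ there are $M$ densities on some measure space such that, for every density estimator $\widehat p$ based on $n$ observations, some density $p^\star$ among them satisfies $$\Pr_{X_1,\dots,X_n\sim p^\star}\left(\mathrm{KL}(p^\star,\widehat p)\le c\,\min\left\{\frac{75\log(2M)\log(2/\delta)}{n},\ \log M\right\}\right)<1-\delta .$$ -/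

import Mathlib

open MeasureTheory InformationTheory

noncomputable section

namespace ModelAggregation

variable {𝒳 : Type*}

/-- `p` is a probability density on `𝒳` with respect to the measure `μ`. -/
structure IsDensity [MeasurableSpace 𝒳] (μ : Measure 𝒳) (p : 𝒳 → ℝ) : Prop where
  measurable : Measurable p
  nonneg : ∀ y, 0 ≤ p y
  lintegral_eq_one : ∫⁻ y, ENNReal.ofReal (p y) ∂μ = 1

/-- The distribution `p dμ` with density `p` with respect to `μ`. -/
def law [MeasurableSpace 𝒳] (μ : Measure 𝒳) (p : 𝒳 → ℝ) : Measure 𝒳 :=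
  μ.withDensity fun y => ENNReal.ofReal (p y)

/-- The law of an i.i.d. sample of size `n` drawn from the density `p`. -/
def sampleLaw [MeasurableSpace 𝒳] (μ : Measure 𝒳) (p : 𝒳 → ℝ) (n : ℕ) :
    Measure (Fin n → 𝒳) :=
  Measure.pi fun _ => law μ p

/-- The Kullback-Leibler divergence `KL(p, q) = ∫ p log (p / q) dμ ∈ [0, ∞]` of two densities,
that is, the divergence of the distributions `p dμ` and `q dμ`. -/
def kl [MeasurableSpace 𝒳] (μ : Measure 𝒳) (p q : 𝒳 → ℝ) : ENNReal :=
  klDiv (law μ p) (law μ q)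

/-- A density estimator based on a sample of size `n`: a (jointly measurable) map that sends
every sample to a probability density with respect to `μ`. -/
structure IsDensityEstimator [MeasurableSpace 𝒳] (μ : Measure 𝒳) {n : ℕ}
    (phat : (Fin n → 𝒳) → 𝒳 → ℝ) : Prop where
  measurable : Measurable fun z : (Fin n → 𝒳) × 𝒳 => phat z.1 z.2
  isDensity : ∀ X, IsDensity μ (phat X)

/-- The observation number `k` of a sample, counted from `0`. (It is read modulo `n`, which has
no effect for `k < n`; only such `k` are ever used.) -/
def obs {n : ℕ} [NeZero n] (X : Fin n → 𝒳) (k : ℕ) : 𝒳 := X (Fin.ofNat n k)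

/-- The mixture of the densities `q i`, `i ∈ s`, with weights proportional to `w i`
(with equal weights in the degenerate case where the weights sum to `0`). -/
def mixture {ι : Type*} (s : Finset ι) (q : ι → 𝒳 → ℝ) (w : ι → ℝ) (y : 𝒳) : ℝ :=
  if ∑ h ∈ s, w h = 0 then (∑ i ∈ s, q i y) / (s.card : ℝ)
  else ∑ i ∈ s, q i y * (w i / ∑ h ∈ s, w h)

/-- The unnormalized weights of the shifted progressive mixture: after the observations
`x 0, …, x (t - 1)`, the weight of `i` is
`∏ k < t, (q i (x k) / 2 + phat k (x k) / 2)`, where `phat k` is the mixture with the weights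
obtained after the first `k` observations. -/
def shiftedWeight {ι : Type*} (s : Finset ι) (q : ι → 𝒳 → ℝ) (x : ℕ → 𝒳) : ℕ → ι → ℝ
  | 0, _ => 1
  | t + 1, i => shiftedWeight s q x t i *
      (1 / 2 * q i (x t) + 1 / 2 * mixture s q (shiftedWeight s q x t) (x t))

/-- The shifted progressive mixture rule over the class `q i`, `i ∈ s`, based on the
observations `x 0, …, x (m - 1)`: the average of the `m` successive mixtures. -/
def progressiveMixture {ι : Type*} (s : Finset ι) (q : ι → 𝒳 → ℝ) (x : ℕ → 𝒳) (m : ℕ)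
    (y : 𝒳) : ℝ :=
  (∑ t ∈ Finset.range m, mixture s q (shiftedWeight s q x t) y) / (m : ℝ)

/-- The almost maximum likelihood set computed from `x 0, …, x (m - 1)`. With the normalized
negative log-likelihood `L i = -(1 / m) ∑ k < m, log (p i (x k))`, the condition is
`L i - min_j L j ≤ 2 log (4 M / δ) / m`; it is written here in the exponentiated form, so that
it makes sense also where some likelihoods vanish. -/
def almostMLE {M : ℕ} (p : Fin M → 𝒳 → ℝ) (δ : ℝ) (x : ℕ → 𝒳) (m : ℕ) : Finset (Fin M) := by
  classical
  exact Finset.univ.filter fun i => ∀ j,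
    ∏ k ∈ Finset.range m, p j (x k) ≤ (4 * M / δ) ^ 2 * ∏ k ∈ Finset.range m, p i (x k)

/-- The smoothed class `p i / 2 + (1 / (2 |W|)) ∑ j ∈ W, p j`, for `i ∈ W`. -/
def smoothed {M : ℕ} (p : Fin M → 𝒳 → ℝ) (W : Finset (Fin M)) (i : Fin M) (y : 𝒳) : ℝ :=
  1 / 2 * p i y + 1 / (2 * (W.card : ℝ)) * ∑ j ∈ W, p j y

/-- The model aggregation estimator with confidence parameter `δ`. If `n ≤ 75 log (2 / δ)`, it
is the uniform mixture of the dictionary. Otherwise the first `⌊n / 2⌋` observations give the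
almost maximum likelihood set `W`, and the shifted progressive mixture rule is run over the
smoothed class of `W` on the next `⌊n / 2⌋` observations. -/
def aggregate {M n : ℕ} [NeZero n] (p : Fin M → 𝒳 → ℝ) (δ : ℝ) (X : Fin n → 𝒳) : 𝒳 → ℝ := by
  classical
  exact
    if (n : ℝ) ≤ 75 * Real.log (2 / δ) then fun y => (∑ i, p i y) / (M : ℝ)
    else
      progressiveMixture (almostMLE p δ (obs X) (n / 2))
        (smoothed p (almostMLE p δ (obs X) (n / 2))) (fun k => obs X (n / 2 + k)) (n / 2)

end ModelAggregation

end

/-! Upper bound, large `n`. Let `p` be the true density, with index `i`. The total shifted weight is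
multiplied at each step by exactly `p̂_t(Y_t)`, so for `i ∈ W` the observed product of the ratios `2
p̂_t / (q_i + p̂_t)` is at least `1/M` (`prod_shifted_le_card_mul_prod`). On the other hand, given
the past, the power `2γ` of such a ratio has expectation at most `exp(-γ (3/4 KL(p, p̂_t) - 2h))`
(`IsDensity.lintegral_shifted_ratio_le`), where `1 - h` bounds from below the Hellinger affinity of
`p` with the average over `W`. Compensating the exponent gives a nonnegative supermartingale, and
Markov's inequality at level `2/δ` yields `∑ KL(p, p̂_t) ≤ 4/3 (2mh + 2 log M + log(2/δ)/γ)`.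
Concavity of `log` passes this to the average of the `p̂_t` (`kl_progressiveMixture_le`).

Smoothing has two roles. It gives `p ≤ 2M p̂_t`, so that `γ = 1/(2 log(2M) + 5)` is admissible; this
is the source of the product `log(2M) log(2/δ)`. It also makes `q_i` the midpoint of `p` and the
average over `W`, so the second-order term is controlled by `h`. The likelihood test on the first
half keeps the true index and discards densities far from `p` in Hellinger distance, so `mh` is at
most `2 log(4M/δ)` (`measure_not_isLocalizedAt_le`).

Lower bound. Take `M` densities sharing an atom of mass `1 - e`, each with its own atom of mass `e`.
With probability `(1 - e)^n > δ` only the common atom is seen, and the single density then returned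
is at divergence at least `e log M` from one of them (`exists_kl_spike_ge`). -/

noncomputable section

namespace ModelAggregation

/-! ### Likelihood ratios and divergence under a density -/

section Law

variable {𝒳 : Type*} [MeasurableSpace 𝒳] {μ : Measure 𝒳} {p q f : 𝒳 → ℝ}

theorem IsDensity.isProbabilityMeasure_law (hp : IsDensity μ p) :
    IsProbabilityMeasure (law μ p) :=
  ⟨by rw [law, withDensity_apply _ MeasurableSet.univ, Measure.restrict_univ,
    hp.lintegral_eq_one]⟩

theorem IsDensity.ae_pos (hp : IsDensity μ p) : ∀ᵐ y ∂law μ p, 0 < p y := by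
  rw [law, ae_withDensity_iff hp.measurable.ennreal_ofReal]
  exact Filter.Eventually.of_forall fun y hy => by
    simpa [ENNReal.ofReal_eq_zero] using hy

/-- Only an inequality: the mass that `f` puts on `{p = 0}` is lost. -/
theorem IsDensity.lintegral_div_law_le (hp : IsDensity μ p) (hf : IsDensity μ f) :
    ∫⁻ y, ENNReal.ofReal (f y / p y) ∂law μ p ≤ 1 := by
  have hm : Measurable fun y => ENNReal.ofReal (f y / p y) :=
    (hf.measurable.div hp.measurable).ennreal_ofReal
  rw [law, lintegral_withDensity_eq_lintegral_mul _ hp.measurable.ennreal_ofReal hm,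
    ← hf.lintegral_eq_one]
  refine lintegral_mono fun y => ?_
  rw [Pi.mul_apply, ← ENNReal.ofReal_mul (hp.nonneg y)]
  refine ENNReal.ofReal_le_ofReal ?_
  rcases (hp.nonneg y).eq_or_lt with h | h
  · rw [← h]; simpa using hf.nonneg y
  · rw [mul_div_cancel₀ _ h.ne']

theorem IsDensity.integrable_div_law (hp : IsDensity μ p) (hf : IsDensity μ f) :
    Integrable (fun y => f y / p y) (law μ p) := by
  refine ⟨(hf.measurable.div hp.measurable).aestronglyMeasurable, ?_⟩
  rw [hasFiniteIntegral_iff_ofReal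
    (Filter.Eventually.of_forall fun y => div_nonneg (hf.nonneg y) (hp.nonneg y))]
  exact (hp.lintegral_div_law_le hf).trans_lt ENNReal.one_lt_top

theorem IsDensity.integral_div_law_le (hp : IsDensity μ p) (hf : IsDensity μ f) :
    ∫ y, f y / p y ∂law μ p ≤ 1 := by
  rw [integral_eq_lintegral_of_nonneg_ae
    (Filter.Eventually.of_forall fun y => div_nonneg (hf.nonneg y) (hp.nonneg y))
    (hf.measurable.div hp.measurable).aestronglyMeasurable]
  exact ENNReal.toReal_le_of_le_ofReal zero_le_one (by simpa using hp.lintegral_div_law_le hf)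

theorem IsDensity.integrable_sqrt_div_law (hp : IsDensity μ p) (hf : IsDensity μ f) :
    Integrable (fun y => √(f y / p y)) (law μ p) := by
  have := hp.isProbabilityMeasure_law
  refine ((integrable_const (1 : ℝ)).add (hp.integrable_div_law hf)).mono'
    (hf.measurable.div hp.measurable).sqrt.aestronglyMeasurable
    (Filter.Eventually.of_forall fun y => ?_)
  have h : 0 ≤ f y / p y := div_nonneg (hf.nonneg y) (hp.nonneg y)
  rw [Real.norm_of_nonneg (Real.sqrt_nonneg _)]
  simp only [Pi.add_apply]
  nlinarith [Real.sq_sqrt h, sq_nonneg (√(f y / p y) - 1)]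

/-- The logarithm is at most `log C` by domination and at least `1 - q / p` by `log x ≤ x - 1`, and
`q / p` is integrable under `p`. -/
theorem IsDensity.integrable_log_div (hp : IsDensity μ p) (hq : IsDensity μ q) {C : ℝ}
    (hC : ∀ y, p y ≤ C * q y) : Integrable (fun y => Real.log (p y / q y)) (law μ p) := by
  have := hp.isProbabilityMeasure_law
  refine ((integrable_const |Real.log C|).add (hp.integrable_div_law hq)).mono'
    (hp.measurable.div hq.measurable).log.aestronglyMeasurable ?_
  filter_upwards [hp.ae_pos] with y hy
  have hq0 : 0 < q y := (hq.nonneg y).lt_of_ne fun h => by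
    have := hC y; rw [← h] at this; linarith
  have h1 : Real.log (p y / q y) ≤ Real.log C :=
    Real.log_le_log (div_pos hy hq0) ((div_le_iff₀ hq0).2 (hC y))
  have h2 := Real.log_le_sub_one_of_pos (div_pos hq0 hy)
  have h3 : Real.log (p y / q y) = - Real.log (q y / p y) := by
    rw [← Real.log_inv, inv_div]
  have h4 : 0 < q y / p y := div_pos hq0 hy
  rw [Real.norm_eq_abs, abs_le, Pi.add_apply]
  have := le_abs_self (Real.log C)
  have := abs_nonneg (Real.log C)
  constructor <;> linarith

/-- For a density `p` dominated by a multiple of `q`, the divergence is given by the usual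
integral. -/
theorem IsDensity.kl_eq (hp : IsDensity μ p) (hq : IsDensity μ q) {C : ℝ}
    (hC : ∀ y, p y ≤ C * q y) :
    kl μ p q = ENNReal.ofReal (∫ y, Real.log (p y / q y) ∂law μ p) := by
  have := hp.isProbabilityMeasure_law
  have := hq.isProbabilityMeasure_law
  have hq0 : ∀ y, 0 < p y → 0 < q y := fun y hy => (hq.nonneg y).lt_of_ne fun h => by
    have := hC y; rw [← h] at this; linarith
  have hm : Measurable fun y => ENNReal.ofReal (p y / q y) :=
    (hp.measurable.div hq.measurable).ennreal_ofReal
  -- Where `q` vanishes so does `p`, so `p / q` with its default value `0` is a density of `law μ p`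
  -- relative to `law μ q`.
  have hlaw : law μ p = (law μ q).withDensity fun y => ENNReal.ofReal (p y / q y) := by
    rw [law, law, ← withDensity_mul _ hq.measurable.ennreal_ofReal hm]
    congr 1
    funext y
    rw [Pi.mul_apply, ← ENNReal.ofReal_mul (hq.nonneg y)]
    rcases (hq.nonneg y).eq_or_lt with h | h
    · have h' : ¬ 0 < p y := fun hy => (hq0 y hy).ne h
      have : p y = 0 := le_antisymm (not_lt.1 h') (hp.nonneg y)
      simp [this]
    · rw [mul_div_cancel₀ _ h.ne']
  have hac : law μ p ≪ law μ q := by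
    rw [hlaw]; exact withDensity_absolutelyContinuous _ _
  have hrn : (law μ p).rnDeriv (law μ q) =ᵐ[law μ p] fun y => ENNReal.ofReal (p y / q y) := by
    refine hac.ae_le ?_
    have h := Measure.rnDeriv_withDensity (law μ q) hm
    rwa [← hlaw] at h
  have hllr : llr (law μ p) (law μ q) =ᵐ[law μ p] fun y => Real.log (p y / q y) := by
    filter_upwards [hrn] with y hy
    rw [llr, hy, ENNReal.toReal_ofReal (div_nonneg (hp.nonneg y) (hq.nonneg y))]
  rw [kl, klDiv_of_ac_of_integrable hac ((hp.integrable_log_div hq hC).congr hllr.symm),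
    integral_congr_ae hllr]
  simp

end Law

/-! ### Products of adapted factors along an i.i.d. sample -/

section Chain

variable {𝒳 : Type*}

theorem obs_of_lt {n : ℕ} [NeZero n] (X : Fin n → 𝒳) {k : ℕ} (hk : k < n) :
    obs X k = X ⟨k, hk⟩ := by
  rw [obs]
  congr 1
  ext
  simp [Nat.mod_eq_of_lt hk]

variable [MeasurableSpace 𝒳]

theorem measurable_obs {n : ℕ} [NeZero n] :
    Measurable (obs : (Fin n → 𝒳) → ℕ → 𝒳) :=
  measurable_pi_lambda _ fun _ => measurable_pi_apply _

/-- The product of factors `Φ k`, where `Φ k` is adapted and has conditional expectation at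
most `1` given the past, has expectation at most `1`. -/
theorem lintegral_prod_adapted_le_one {n : ℕ} [NeZero n] (P : Measure 𝒳)
    [IsProbabilityMeasure P] (Φ : ℕ → (ℕ → 𝒳) → ENNReal) (hΦ : ∀ k, Measurable (Φ k))
    (hdep : ∀ k x x', (∀ i ≤ k, x i = x' i) → Φ k x = Φ k x') (N : ℕ) (hN : N ≤ n)
    (hint : ∀ k < N, ∀ x, ∫⁻ y, Φ k (Function.update x k y) ∂P ≤ 1) :
    ∫⁻ X : Fin n → 𝒳, ∏ k ∈ Finset.range N, Φ k (obs X) ∂Measure.pi (fun _ => P) ≤ 1 := by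
  induction N with
  | zero => simp
  | succ t ih =>
    refine le_trans ?_ (ih (by omega) fun k hk => hint k (by omega))
    have hmeas : ∀ N, Measurable fun X : Fin n → 𝒳 => ∏ k ∈ Finset.range N, Φ k (obs X) :=
      fun N => Finset.measurable_prod _ fun k _ => (hΦ k).comp measurable_obs
    refine lintegral_le_of_lmarginal_le {(⟨t, by omega⟩ : Fin n)} (hmeas _) (hmeas _) ?_
    intro X
    -- Restricted to `k ≤ t` because `obs` wraps around modulo `n`; by `hdep` later positions are
    -- never read.
    have hupd : ∀ y k, k ≤ t → obs (Function.update X ⟨t, by omega⟩ y) k =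
        Function.update (obs X) t y k := by
      intro y k hk
      rw [obs_of_lt _ (by omega)]
      rcases hk.eq_or_lt with rfl | h
      · simp
      · rw [Function.update_of_ne (by simp [Fin.ext_iff]; omega),
          Function.update_of_ne (by omega), obs_of_lt _ (by omega)]
    have hpast : ∀ y, ∏ k ∈ Finset.range t, Φ k (obs (Function.update X ⟨t, by omega⟩ y)) =
        ∏ k ∈ Finset.range t, Φ k (obs X) := by
      intro y
      refine Finset.prod_congr rfl fun k hk => hdep _ _ _ fun i hi => ?_
      rw [Finset.mem_range] at hk
      rw [hupd _ _ (by omega), Function.update_of_ne (by omega)]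
    rw [lmarginal_singleton, lmarginal_singleton]
    simp only [Finset.prod_range_succ, hpast]
    have hlast : ∀ y, Φ t (obs (Function.update X ⟨t, by omega⟩ y)) =
        Φ t (Function.update (obs X) t y) := fun y =>
      hdep _ _ _ fun i hi => hupd y i hi
    simp only [hlast]
    have hm : Measurable fun y => Φ t (Function.update (obs X) t y) :=
      (hΦ t).comp (measurable_update _)
    rw [lintegral_const_mul _ hm, lintegral_const]
    simpa using mul_le_mul_right (hint t (by omega) (obs X)) _

/-- Markov's inequality at one fixed horizon; no maximal inequality is needed. -/
theorem measure_le_of_prod_adapted {n : ℕ} [NeZero n] (P : Measure 𝒳)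
    [IsProbabilityMeasure P] (Φ : ℕ → (ℕ → 𝒳) → ENNReal) (hΦ : ∀ k, Measurable (Φ k))
    (hdep : ∀ k x x', (∀ i ≤ k, x i = x' i) → Φ k x = Φ k x') (N : ℕ) (hN : N ≤ n)
    (hint : ∀ k < N, ∀ x, ∫⁻ y, Φ k (Function.update x k y) ∂P ≤ 1) {T : ℝ} (hT : 0 < T) :
    Measure.pi (fun _ => P) {X : Fin n → 𝒳 |
      ENNReal.ofReal T ≤ ∏ k ∈ Finset.range N, Φ k (obs X)} ≤ ENNReal.ofReal (1 / T) := by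
  have h0 : ENNReal.ofReal T ≠ 0 := by simpa using hT
  refine (meas_ge_le_lintegral_div (Finset.measurable_prod _ fun k _ =>
    (hΦ k).comp measurable_obs).aemeasurable h0 ENNReal.ofReal_ne_top).trans ?_
  rw [ENNReal.ofReal_div_of_pos hT, ENNReal.ofReal_one]
  exact ENNReal.div_le_div_right (lintegral_prod_adapted_le_one P Φ hΦ hdep N hN hint) _

theorem ae_forall_obs {n : ℕ} [NeZero n] (P : Measure 𝒳) [IsProbabilityMeasure P]
    {S : 𝒳 → Prop} (hS : ∀ᵐ y ∂P, S y) :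
    ∀ᵐ X : Fin n → 𝒳 ∂Measure.pi (fun _ => P), ∀ k, S (obs X k) := by
  rw [ae_all_iff]
  exact fun k => (Measure.tendsto_eval_ae_ae (i := Fin.ofNat n k)).eventually hS

end Chain

/-! ### Scalar inequalities -/

section Inequalities

/-- `(1 - z + z²/2)(1 + z + z²/2) = 1 + z⁴/4 ≥ 1`, so the quadratic lower bound for `exp z` can be
inverted. -/
theorem exp_neg_le_quadratic {z : ℝ} (hz : 0 ≤ z) : Real.exp (-z) ≤ 1 - z + z ^ 2 / 2 := by
  have h := Real.quadratic_le_exp_of_nonneg hz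
  have hpos : 0 < 1 + z + z ^ 2 / 2 := by positivity
  rw [Real.exp_neg]
  refine (inv_anti₀ hpos h).trans ?_
  rw [inv_le_iff_one_le_mul₀ hpos]
  nlinarith [sq_nonneg (z ^ 2)]

/-- Equivalent to `2 - s ≤ (s + 2) e^{-s}`: trivial for `s ≥ 2`, otherwise the Padé bound `e^s ≤ (2
+ s)/(2 - s)`. It trades a second-order term for the divergence integrand at the price of a factor
`s + 2`. -/
theorem sq_le_add_two_mul_exp_neg {s : ℝ} (hs : 0 ≤ s) :
    s ^ 2 ≤ (s + 2) * (Real.exp (-s) - 1 + s) := by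
  have key : 2 - s ≤ (s + 2) * Real.exp (-s) := by
    rcases le_or_gt 2 s with h | h
    · have := Real.exp_pos (-s)
      nlinarith
    · have h2 : 0 < 2 - s := by linarith
      have h1 := Real.le_log_one_add_of_nonneg (x := 2 * s / (2 - s)) (by positivity)
      have e1 : 2 * (2 * s / (2 - s)) / (2 * s / (2 - s) + 2) = s := by
        field_simp
        ring
      have e2 : 1 + 2 * s / (2 - s) = (2 + s) / (2 - s) := by
        field_simp
        ring
      rw [e1, e2, Real.le_log_iff_exp_le (by positivity), le_div_iff₀ h2] at h1
      rw [Real.exp_neg, ← div_eq_mul_inv, le_div_iff₀ (Real.exp_pos s)]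
      linarith
  nlinarith

/-- A quantitative form of Bernoulli's inequality for `x ^ β`, with a remainder comparable to
the integrand `x - 1 - log x` of the Kullback-Leibler divergence. -/
theorem rpow_le_sub_log {x K : ℝ} (hx : 0 < x) (hK : 1 ≤ Real.log K)
    (hxK : 1 ≤ K * x) :
    x ^ (1 / (2 * (Real.log K + 2))) ≤ 1 + 1 / (2 * (Real.log K + 2)) * (x - 1)
      - 3 / 4 * (1 / (2 * (Real.log K + 2))) * (x - 1 - Real.log x) := by
  set Λ := Real.log K with hΛ
  set β := 1 / (2 * (Λ + 2)) with hβ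
  have hβ0 : 0 < β := by positivity
  have hβΛ : 2 * β * (Λ + 2) = 1 := by rw [hβ]; field_simp
  rcases le_or_gt x 1 with h1 | h1
  · set s := -Real.log x with hs
    have hs0 : 0 ≤ s := by have := Real.log_nonpos hx.le h1; linarith
    have hxs : x = Real.exp (-s) := by rw [hs, neg_neg, Real.exp_log hx]
    have hK0 : 0 < K := by
      by_contra h
      nlinarith
    have hsΛ : s ≤ Λ := by
      have := Real.log_nonneg hxK
      rw [Real.log_mul hK0.ne' hx.ne'] at this
      linarith
    have hpow : x ^ β = Real.exp (-(β * s)) := by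
      rw [Real.rpow_def_of_pos hx]
      congr 1
      rw [hs]; ring
    have e1 := exp_neg_le_quadratic (z := β * s) (by positivity)
    have e2 := sq_le_add_two_mul_exp_neg hs0
    have hψ : 0 ≤ Real.exp (-s) - 1 + s := by
      have := Real.add_one_le_exp (-s)
      linarith
    -- From `s ≤ Λ` and `2β(Λ + 2) = 1`. The quadratic term `β²s²/2` then costs a quarter of `β
    -- (e^{-s} - 1 + s)`, which leaves the constant `3/4`.
    have e3 : 2 * β * s ^ 2 ≤ Real.exp (-s) - 1 + s := by
      calc 2 * β * s ^ 2 ≤ 2 * β * ((s + 2) * (Real.exp (-s) - 1 + s)) := by gcongr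
        _ ≤ 2 * β * ((Λ + 2) * (Real.exp (-s) - 1 + s)) := by gcongr
        _ = Real.exp (-s) - 1 + s := by rw [← mul_assoc, hβΛ, one_mul]
    have hlog : Real.log x = -s := by rw [hs, neg_neg]
    rw [hpow, hlog, hxs]
    nlinarith [mul_le_mul_of_nonneg_left e3 hβ0.le]
  · set v := x ^ β with hv
    have hv1 : 1 ≤ v := Real.one_le_rpow h1.le hβ0.le
    have hv0 : 0 < v := by linarith
    have hlogv : Real.log v = β * Real.log x := Real.log_rpow hx β
    have hlog : (v - 1) - (v - 1) ^ 2 / 2 ≤ Real.log v := by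
      have h := Real.le_log_one_add_of_nonneg (x := v - 1) (by linarith)
      rw [add_sub_cancel] at h
      refine le_trans ?_ h
      rw [le_div_iff₀ (by linarith)]
      nlinarith [pow_nonneg (sub_nonneg.2 hv1) 3]
    -- For `x > 1`, Bernoulli applied to `x = v^{2(Λ + 2)}` gives `β(x - 1)` a term `(Λ + 2)/2 · (v
    -- - 1)²`. Since `Λ ≥ 1`, a quarter of it covers the loss `3/4 · (v - 1)²/2` coming from `log
    -- v`.
    have hxv : x = (v ^ (Λ + 2)) ^ 2 := by
      rw [hv, ← Real.rpow_natCast, ← Real.rpow_mul hx.le, ← Real.rpow_mul hx.le]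
      have : β * (Λ + 2) * ((2 : ℕ) : ℝ) = 1 := by push_cast; linarith
      rw [this, Real.rpow_one]
    have hbern : 1 + (Λ + 2) * (v - 1) ≤ v ^ (Λ + 2) := by
      have := one_add_mul_self_le_rpow_one_add (s := v - 1) (by linarith)
        (p := Λ + 2) (by linarith)
      rwa [add_sub_cancel] at this
    have hx2 : (1 + (Λ + 2) * (v - 1)) ^ 2 ≤ x := by
      rw [hxv]
      have : 0 ≤ (Λ + 2) * (v - 1) := mul_nonneg (by linarith) (by linarith)
      gcongr
    have h3 : β * ((1 + (Λ + 2) * (v - 1)) ^ 2 - 1) ≤ β * (x - 1) := by gcongr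
    have h4 : β * ((1 + (Λ + 2) * (v - 1)) ^ 2 - 1) =
        (v - 1) + (Λ + 2) / 2 * (v - 1) ^ 2 := by
      have : β * ((1 + (Λ + 2) * (v - 1)) ^ 2 - 1) =
        (2 * β * (Λ + 2)) * ((v - 1) + (Λ + 2) / 2 * (v - 1) ^ 2) := by ring
      rw [this, hβΛ, one_mul]
    nlinarith [mul_nonneg (by linarith : 0 ≤ Λ - 1) (sq_nonneg (v - 1))]

/-- The shifted likelihood ratio is controlled by a likelihood ratio and a chi-square term. -/
theorem shifted_ratio_rpow_le {p r a γ : ℝ} (hp : 0 < p) (hr : 0 < r) (ha : 0 < a)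
    (hγ0 : 0 < γ) (hγ1 : γ < 1) :
    (2 * r / (a + r)) ^ (2 * γ) ≤ γ * (p / a) + (1 - γ) * (r / p) ^ (γ / (1 - γ)) := by
  -- This is `4ar ≤ (a + r)²`. Then `r/a = (p/a)(r/p)` is split by the weighted arithmetic-geometric
  -- mean with weights `γ` and `1 - γ`.
  have h1 : (2 * r / (a + r)) ^ (2 * γ) ≤ (r / a) ^ γ := by
    rw [Real.rpow_mul (by positivity)]
    refine Real.rpow_le_rpow (by positivity) ?_ hγ0.le
    rw [Real.rpow_two, div_pow, div_le_div_iff₀ (by positivity) ha]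
    nlinarith [mul_nonneg hr.le (sq_nonneg (a - r))]
  have h2 : (r / a) ^ γ = (p / a) ^ γ * ((r / p) ^ (γ / (1 - γ))) ^ (1 - γ) := by
    rw [← Real.rpow_mul (by positivity), div_mul_cancel₀ _ (by linarith : 1 - γ ≠ 0),
      ← Real.mul_rpow (by positivity) (by positivity)]
    congr 1
    field_simp
  rw [h2] at h1
  exact h1.trans (Real.geom_mean_le_arith_mean2_weighted hγ0.le (by linarith) (by positivity)
    (by positivity) (by ring))

/-- With `u = √(w/p)`, the right side minus the left is `(u - 1)⁴ / (2(1 + u²))`. Integrated under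
`p`, an affinity of at least `1 - h` bounds the mean of the left side by `1 + 2h`. -/
theorem div_midpoint_le {p w : ℝ} (hp : 0 < p) (hw : 0 ≤ w) :
    p / (1 / 2 * p + 1 / 2 * w) ≤ 5 / 2 + 1 / 2 * (w / p) - 2 * √(w / p) := by
  obtain ⟨u, hu0, hu⟩ : ∃ u, 0 ≤ u ∧ w = u ^ 2 * p :=
    ⟨√(w / p), Real.sqrt_nonneg _, by
      rw [Real.sq_sqrt (by positivity), div_mul_cancel₀ _ hp.ne']⟩
  have e1 : w / p = u ^ 2 := by rw [hu, mul_div_cancel_right₀ _ hp.ne']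
  have e2 : p / (1 / 2 * p + 1 / 2 * w) = 2 / (1 + u ^ 2) := by
    rw [hu]; field_simp
  rw [e1, e2, Real.sqrt_sq hu0, div_le_iff₀ (by positivity)]
  nlinarith [sq_nonneg (u ^ 2 - 2 * u + 1), sq_nonneg (u - 1)]

end Inequalities

/-! ### One-step exponential moment -/

section OneStep

variable {𝒳 : Type*} [MeasurableSpace 𝒳] {μ : Measure 𝒳} {p r w : 𝒳 → ℝ}

/-- The conditional exponential moment of the shifted log-loss difference. -/
theorem IsDensity.lintegral_shifted_ratio_le (hp : IsDensity μ p) (hr : IsDensity μ r)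
    (hw : IsDensity μ w) {a : 𝒳 → ℝ} (ha : ∀ y, a y = 1 / 2 * p y + 1 / 2 * w y)
    {K h γ : ℝ} (hK : 1 ≤ Real.log K) (hKr : ∀ y, p y ≤ K * r y)
    (hh : 1 - h ≤ ∫ y, √(w y / p y) ∂law μ p) (hγ : γ = 1 / (2 * Real.log K + 5)) :
    ∫⁻ y, ENNReal.ofReal ((2 * r y / (a y + r y)) ^ (2 * γ)) ∂law μ p ≤
      ENNReal.ofReal (Real.exp
        (-(γ * (3 / 4 * ∫ y, Real.log (p y / r y) ∂law μ p - 2 * h)))) := by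
  have := hp.isProbabilityMeasure_law
  have hγ0 : 0 < γ := by rw [hγ]; positivity
  have hγ1 : γ < 1 := by rw [hγ, div_lt_one (by positivity)]; linarith
  -- The value of `γ` makes the exponent left by the weighted mean equal to that of
  -- `rpow_le_sub_log`.
  have hβ : γ / (1 - γ) = 1 / (2 * (Real.log K + 2)) := by
    have : (1 - γ) ≠ 0 := by linarith
    rw [div_eq_div_iff this (by positivity)]
    rw [hγ]
    field_simp
    ring
  set β := 1 / (2 * (Real.log K + 2))
  have hγβ : (1 - γ) * β = γ := by
    rw [← hβ, mul_div_cancel₀ _ (by linarith : 1 - γ ≠ 0)]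
  have iw := hp.integrable_div_law hw
  have isq := hp.integrable_sqrt_div_law hw
  have ir := hp.integrable_div_law hr
  have il := hp.integrable_log_div hr hKr
  -- `w/p` and `r/p` enter with positive coefficients, so means at most `1` suffice; `√(w/p)` enters
  -- with a negative one and needs the lower bound `hh`.
  let g : 𝒳 → ℝ := fun y => (γ * (5 / 2) + (1 - γ) - 1 / 4 * γ) + γ / 2 * (w y / p y)
    + (-(2 * γ)) * √(w y / p y) + γ / 4 * (r y / p y) + (-(3 / 4 * γ)) * Real.log (p y / r y)
  have hle : ∀ᵐ y ∂law μ p, (2 * r y / (a y + r y)) ^ (2 * γ) ≤ g y := by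
    filter_upwards [hp.ae_pos] with y hy
    have hr0 : 0 < r y := (hr.nonneg y).lt_of_ne fun h0 => by
      have := hKr y; rw [← h0] at this; linarith
    have ha0 : 0 < a y := by rw [ha]; linarith [hw.nonneg y]
    have h1 := shifted_ratio_rpow_le hy hr0 ha0 hγ0 hγ1
    have h2 := div_midpoint_le hy (hw.nonneg y)
    rw [← ha] at h2
    have h3 := rpow_le_sub_log (x := r y / p y) (K := K) (div_pos hr0 hy) hK (by
      rw [← mul_div_assoc, one_le_div hy]; exact hKr y)
    have h4 : Real.log (r y / p y) = -Real.log (p y / r y) := by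
      rw [← Real.log_inv, inv_div]
    rw [h4] at h3
    rw [hβ] at h1
    refine h1.trans ?_
    have h5 := mul_le_mul_of_nonneg_left h2 hγ0.le
    have h6 := mul_le_mul_of_nonneg_left h3 (by linarith : 0 ≤ 1 - γ)
    have h7 : (1 - γ) * (1 + β * (r y / p y - 1) -
        3 / 4 * β * (r y / p y - 1 - -Real.log (p y / r y))) =
        (1 - γ) + ((1 - γ) * β) * (r y / p y - 1) -
        3 / 4 * ((1 - γ) * β) * (r y / p y - 1 + Real.log (p y / r y)) := by ring
    rw [h7, hγβ] at h6
    simp only [g]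
    linarith
  have hg0 : 0 ≤ᵐ[law μ p] g := by
    filter_upwards [hle] with y hy
    refine le_trans (Real.rpow_nonneg (div_nonneg (by linarith [hr.nonneg y]) ?_) _) hy
    rw [ha]; linarith [hr.nonneg y, hp.nonneg y, hw.nonneg y]
  set c₀ := γ * (5 / 2) + (1 - γ) - 1 / 4 * γ with hc₀
  have i1 : Integrable (fun y => c₀ + γ / 2 * (w y / p y)) (law μ p) :=
    (integrable_const _).add (iw.const_mul _)
  have i2 : Integrable (fun y => c₀ + γ / 2 * (w y / p y) + (-(2 * γ)) * √(w y / p y))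
    (law μ p) := i1.add (isq.const_mul _)
  have i3 : Integrable (fun y => c₀ + γ / 2 * (w y / p y) + (-(2 * γ)) * √(w y / p y) +
    γ / 4 * (r y / p y)) (law μ p) := i2.add (ir.const_mul _)
  have hgi : Integrable g (law μ p) := i3.add (il.const_mul _)
  have hint : ∫ y, g y ∂law μ p = c₀ +
      γ / 2 * ∫ y, w y / p y ∂law μ p + (-(2 * γ)) * ∫ y, √(w y / p y) ∂law μ p +
      γ / 4 * ∫ y, r y / p y ∂law μ p + (-(3 / 4 * γ)) * ∫ y, Real.log (p y / r y) ∂law μ p := by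
    simp only [g]
    rw [integral_add i3 (il.const_mul _), integral_add i2 (ir.const_mul _),
      integral_add i1 (isq.const_mul _), integral_add (integrable_const _) (iw.const_mul _)]
    simp only [integral_const_mul, integral_const, probReal_univ, one_smul]
  calc ∫⁻ y, ENNReal.ofReal ((2 * r y / (a y + r y)) ^ (2 * γ)) ∂law μ p
      ≤ ∫⁻ y, ENNReal.ofReal (g y) ∂law μ p :=
        lintegral_mono_ae (by filter_upwards [hle] with y hy using ENNReal.ofReal_le_ofReal hy)
    _ = ENNReal.ofReal (∫ y, g y ∂law μ p) :=
        (ofReal_integral_eq_lintegral_ofReal hgi hg0).symm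
    _ ≤ _ := by
        refine ENNReal.ofReal_le_ofReal ?_
        refine le_trans ?_ (Real.add_one_le_exp _)
        rw [hint]
        have h1 := mul_le_mul_of_nonneg_left (hp.integral_div_law_le hw) hγ0.le
        have h2 := mul_le_mul_of_nonneg_left (hp.integral_div_law_le hr) hγ0.le
        have h3 := mul_le_mul_of_nonneg_left hh hγ0.le
        nlinarith

end OneStep

/-! ### Mixtures and shifted exponential weights -/

section Mixture

variable {𝒳 : Type*} {ι : Type*}

theorem mixture_eq_convexComb {s : Finset ι} (hs : s.Nonempty) (q : ι → 𝒳 → ℝ) {w : ι → ℝ}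
    (hw : ∀ i, 0 ≤ w i) : ∃ c : ι → ℝ, (∀ i, 0 ≤ c i) ∧ ∑ i ∈ s, c i = 1 ∧
      ∀ y, mixture s q w y = ∑ i ∈ s, c i * q i y := by
  by_cases h : ∑ h ∈ s, w h = 0
  · refine ⟨fun _ => 1 / s.card, fun _ => by positivity, ?_, fun y => ?_⟩
    · have : (s.card : ℝ) ≠ 0 := by simpa using hs.ne_empty
      simp [this]
    · rw [mixture, if_pos h, ← Finset.mul_sum]
      ring
  · refine ⟨fun i => w i / ∑ h ∈ s, w h,
      fun i => div_nonneg (hw i) (Finset.sum_nonneg fun i _ => hw i), ?_, fun y => ?_⟩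
    · rw [← Finset.sum_div, div_self h]
    · rw [mixture, if_neg h]
      exact Finset.sum_congr rfl fun i _ => mul_comm _ _

theorem le_mixture {s : Finset ι} (hs : s.Nonempty) {q : ι → 𝒳 → ℝ} {w : ι → ℝ}
    (hw : ∀ i, 0 ≤ w i) {y : 𝒳} {b : ℝ} (hb : ∀ i ∈ s, b ≤ q i y) : b ≤ mixture s q w y := by
  obtain ⟨c, hc0, hc1, hc⟩ := mixture_eq_convexComb hs q hw
  rw [hc]
  calc b = ∑ i ∈ s, c i * b := by rw [← Finset.sum_mul, hc1, one_mul]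
    _ ≤ _ := Finset.sum_le_sum fun i hi => mul_le_mul_of_nonneg_left (hb i hi) (hc0 i)

theorem mixture_nonneg {s : Finset ι} {q : ι → 𝒳 → ℝ} {w : ι → ℝ}
    (hw : ∀ i, 0 ≤ w i) {y : 𝒳} (hq : ∀ i, 0 ≤ q i y) : 0 ≤ mixture s q w y := by
  rw [mixture]
  split_ifs
  · exact div_nonneg (Finset.sum_nonneg fun i _ => hq i) (Nat.cast_nonneg _)
  · exact Finset.sum_nonneg fun i _ => mul_nonneg (hq i)
      (div_nonneg (hw i) (Finset.sum_nonneg fun i _ => hw i))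

theorem shiftedWeight_nonneg {s : Finset ι} {q : ι → 𝒳 → ℝ} (hq : ∀ i y, 0 ≤ q i y)
    (x : ℕ → 𝒳) (t : ℕ) (i : ι) : 0 ≤ shiftedWeight s q x t i := by
  induction t generalizing i with
  | zero => simp [shiftedWeight]
  | succ t ih =>
    rw [shiftedWeight]
    have := mixture_nonneg (s := s) ih (hq · (x t))
    have := hq i (x t)
    exact mul_nonneg (ih i) (by linarith)

theorem shiftedWeight_congr (s : Finset ι) (q : ι → 𝒳 → ℝ) {x x' : ℕ → 𝒳} {t : ℕ}
    (h : ∀ k < t, x k = x' k) : shiftedWeight s q x t = shiftedWeight s q x' t := by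
  induction t with
  | zero => funext i; simp [shiftedWeight]
  | succ t ih =>
    funext i
    rw [shiftedWeight, shiftedWeight, ih fun k hk => h k (by omega), h t (by omega)]

/-- The exponential weights identity: the shifted progressive mixture competes with every
element of the class, up to a factor `s.card` in the likelihood. -/
theorem prod_shifted_le_card_mul_prod {s : Finset ι} {q : ι → 𝒳 → ℝ} (hq : ∀ i y, 0 ≤ q i y)
    (x : ℕ → 𝒳) (t : ℕ) {i : ι} (hi : i ∈ s) :
    ∏ k ∈ Finset.range t, (1 / 2 * q i (x k) +
      1 / 2 * mixture s q (shiftedWeight s q x k) (x k)) ≤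
      s.card * ∏ k ∈ Finset.range t, mixture s q (shiftedWeight s q x k) (x k) := by
  have hprod : ∀ t, shiftedWeight s q x t i = ∏ k ∈ Finset.range t, (1 / 2 * q i (x k) +
      1 / 2 * mixture s q (shiftedWeight s q x k) (x k)) := by
    intro t
    induction t with
    | zero => simp [shiftedWeight]
    | succ t ih => rw [Finset.prod_range_succ, shiftedWeight, ih]
  -- Since `∑ w_i q_i = (∑ w_i) p̂`, averaging `(q_i + p̂)/2` gives back `p̂`. If the total weight
  -- is `0`, every weight is `0` and stays so, whatever the default mixture is.
  have hsum : ∀ t, ∑ h ∈ s, shiftedWeight s q x t h =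
      s.card * ∏ k ∈ Finset.range t, mixture s q (shiftedWeight s q x k) (x k) := by
    intro t
    induction t with
    | zero => simp [shiftedWeight]
    | succ t ih =>
      rw [Finset.prod_range_succ, ← mul_assoc, ← ih]
      simp only [shiftedWeight]
      by_cases h0 : ∑ h ∈ s, shiftedWeight s q x t h = 0
      · rw [h0, zero_mul]
        refine Finset.sum_eq_zero fun h hh => ?_
        rw [(Finset.sum_eq_zero_iff_of_nonneg
          fun h _ => shiftedWeight_nonneg hq x t h).1 h0 h hh, zero_mul]
      · have hm : ∑ h ∈ s, shiftedWeight s q x t h * q h (x t) =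
            (∑ h ∈ s, shiftedWeight s q x t h) *
              mixture s q (shiftedWeight s q x t) (x t) := by
          rw [mixture, if_neg h0, Finset.mul_sum]
          refine Finset.sum_congr rfl fun h _ => ?_
          field_simp
        calc _ = 1 / 2 * ∑ h ∈ s, shiftedWeight s q x t h * q h (x t) +
              1 / 2 * ((∑ h ∈ s, shiftedWeight s q x t h) *
                mixture s q (shiftedWeight s q x t) (x t)) := by
              rw [Finset.sum_mul, Finset.mul_sum, Finset.mul_sum, ← Finset.sum_add_distrib]
              exact Finset.sum_congr rfl fun h _ => by ring
          _ = _ := by rw [hm]; ring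
  rw [← hprod, ← hsum]
  exact Finset.single_le_sum (fun h _ => shiftedWeight_nonneg hq x t h) hi

variable [MeasurableSpace 𝒳]

theorem isDensity_convexComb {μ : Measure 𝒳} {s : Finset ι} {q : ι → 𝒳 → ℝ}
    (hq : ∀ i ∈ s, IsDensity μ (q i)) {c : ι → ℝ} (hc0 : ∀ i, 0 ≤ c i)
    (hc1 : ∑ i ∈ s, c i = 1) : IsDensity μ fun y => ∑ i ∈ s, c i * q i y where
  measurable := Finset.measurable_sum _ fun i hi => (hq i hi).measurable.const_mul _
  nonneg y := Finset.sum_nonneg fun i hi => mul_nonneg (hc0 i) ((hq i hi).nonneg y)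
  lintegral_eq_one := by
    have h1 : ∀ y, ENNReal.ofReal (∑ i ∈ s, c i * q i y) =
        ∑ i ∈ s, ENNReal.ofReal (c i) * ENNReal.ofReal (q i y) := fun y => by
      rw [ENNReal.ofReal_sum_of_nonneg
        fun i hi => mul_nonneg (hc0 i) ((hq i hi).nonneg y)]
      exact Finset.sum_congr rfl fun i _ => ENNReal.ofReal_mul (hc0 i)
    simp only [h1]
    rw [lintegral_finsetSum' _ fun i hi =>
      ((hq i hi).measurable.ennreal_ofReal.const_mul _).aemeasurable]
    calc _ = ∑ i ∈ s, ENNReal.ofReal (c i) := Finset.sum_congr rfl fun i hi => by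
          rw [lintegral_const_mul _ (hq i hi).measurable.ennreal_ofReal,
            (hq i hi).lintegral_eq_one, mul_one]
      _ = 1 := by rw [← ENNReal.ofReal_sum_of_nonneg fun i _ => hc0 i, hc1, ENNReal.ofReal_one]

theorem isDensity_average {μ : Measure 𝒳} {s : Finset ι} (hs : s.Nonempty) {q : ι → 𝒳 → ℝ}
    (hq : ∀ i ∈ s, IsDensity μ (q i)) :
    IsDensity μ fun y => (∑ i ∈ s, q i y) / (s.card : ℝ) := by
  have hc : (s.card : ℝ) ≠ 0 := by simpa using hs.ne_empty
  have := isDensity_convexComb hq (c := fun _ => (1 : ℝ) / s.card) (fun _ => by positivity)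
    (by simp [hc])
  convert this using 2 with y
  rw [← Finset.mul_sum]
  ring

theorem isDensity_mixture {μ : Measure 𝒳} {s : Finset ι} (hs : s.Nonempty) {q : ι → 𝒳 → ℝ}
    (hq : ∀ i ∈ s, IsDensity μ (q i)) {w : ι → ℝ} (hw : ∀ i, 0 ≤ w i) :
    IsDensity μ (mixture s q w) := by
  obtain ⟨c, hc0, hc1, hc⟩ := mixture_eq_convexComb hs q hw
  rw [show mixture s q w = _ from funext hc]
  exact isDensity_convexComb hq hc0 hc1

theorem measurable_mixture {α : Type*} [MeasurableSpace α] (s : Finset ι) {q : ι → 𝒳 → ℝ}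
    (hq : ∀ i, Measurable (q i)) {W : α → ι → ℝ} (hW : ∀ i, Measurable fun a => W a i)
    {g : α → 𝒳} (hg : Measurable g) : Measurable fun a => mixture s q (W a) (g a) := by
  have hS : Measurable fun a => ∑ h ∈ s, W a h := Finset.measurable_sum _ fun i _ => hW i
  refine Measurable.ite (hS (measurableSet_singleton 0)) ?_ ?_
  · exact (Finset.measurable_sum _ fun i _ => (hq i).comp hg).div_const _
  · exact Finset.measurable_sum _ fun i _ => ((hq i).comp hg).mul ((hW i).div hS)

theorem measurable_shiftedWeight (s : Finset ι) {q : ι → 𝒳 → ℝ}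
    (hq : ∀ i, Measurable (q i)) (t : ℕ) (i : ι) :
    Measurable fun x : ℕ → 𝒳 => shiftedWeight s q x t i := by
  induction t generalizing i with
  | zero => simp only [shiftedWeight]; exact measurable_const
  | succ t ih =>
    simp only [shiftedWeight]
    exact (ih i).mul ((((hq i).comp (measurable_pi_apply t)).const_mul _).add
      ((measurable_mixture s hq ih (measurable_pi_apply t)).const_mul _))

end Mixture

/-! ### The almost-MLE set, the smoothed class, and validity of the estimator -/

section AlmostMLE

variable {𝒳 : Type*} {M : ℕ}

theorem mem_almostMLE {p : Fin M → 𝒳 → ℝ} {δ : ℝ} {x : ℕ → 𝒳} {m : ℕ} {i : Fin M} :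
    i ∈ almostMLE p δ x m ↔ ∀ j, ∏ k ∈ Finset.range m, p j (x k) ≤
      (4 * M / δ) ^ 2 * ∏ k ∈ Finset.range m, p i (x k) := by
  simp [almostMLE]

theorem almostMLE_congr (p : Fin M → 𝒳 → ℝ) (δ : ℝ) {x x' : ℕ → 𝒳} {m : ℕ}
    (h : ∀ k < m, x k = x' k) : almostMLE p δ x m = almostMLE p δ x' m := by
  have hp : ∀ j, ∏ k ∈ Finset.range m, p j (x k) = ∏ k ∈ Finset.range m, p j (x' k) :=
    fun j => Finset.prod_congr rfl fun k hk => by rw [h k (Finset.mem_range.1 hk)]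
  ext i
  simp only [mem_almostMLE, hp]

/-- A likelihood maximizer always qualifies, because `4M/δ ≥ 1`. This makes the estimator a density
for every sample, including those that lose the true index. -/
theorem almostMLE_nonempty {p : Fin M → 𝒳 → ℝ} (hp : ∀ i y, 0 ≤ p i y) (hM : 2 ≤ M) {δ : ℝ}
    (hδ0 : 0 < δ) (hδ1 : δ < 1) (x : ℕ → 𝒳) (m : ℕ) : (almostMLE p δ x m).Nonempty := by
  have : Nonempty (Fin M) := ⟨⟨0, by omega⟩⟩
  obtain ⟨i, hi⟩ := Finite.exists_max fun i => ∏ k ∈ Finset.range m, p i (x k)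
  refine ⟨i, mem_almostMLE.2 fun j => (hi j).trans ?_⟩
  have hM' : (2 : ℝ) ≤ M := by exact_mod_cast hM
  have h1 : 1 ≤ 4 * M / δ := by rw [le_div_iff₀ hδ0]; linarith
  exact le_mul_of_one_le_left (Finset.prod_nonneg fun k _ => hp i _) (one_le_pow₀ h1)

theorem smoothed_eq (p : Fin M → 𝒳 → ℝ) (W : Finset (Fin M)) (i : Fin M) (y : 𝒳) :
    smoothed p W i y = 1 / 2 * p i y + 1 / 2 * ((∑ j ∈ W, p j y) / (W.card : ℝ)) := by
  rw [smoothed]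
  ring

theorem smoothed_nonneg {p : Fin M → 𝒳 → ℝ} (hp : ∀ i y, 0 ≤ p i y) (W : Finset (Fin M))
    (i : Fin M) (y : 𝒳) : 0 ≤ smoothed p W i y := by
  rw [smoothed_eq]
  have := hp i y
  have : 0 ≤ (∑ j ∈ W, p j y) / (W.card : ℝ) :=
    div_nonneg (Finset.sum_nonneg fun j _ => hp j y) (Nat.cast_nonneg _)
  linarith

/-- Each smoothed density contains `p i / (2|W|)` through the average, hence so does every mixture
of them. The resulting ceiling `log(2M)` on log-ratios determines `γ`. -/
theorem le_mul_mixture_smoothed {p : Fin M → 𝒳 → ℝ} (hp : ∀ i y, 0 ≤ p i y)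
    {W : Finset (Fin M)} {i : Fin M} (hi : i ∈ W) {w : Fin M → ℝ}
    (hw : ∀ i, 0 ≤ w i) (y : 𝒳) : p i y ≤ 2 * M * mixture W (smoothed p W) w y := by
  have hW : W.Nonempty := ⟨i, hi⟩
  have hc : 0 < (W.card : ℝ) := by exact_mod_cast hW.card_pos
  have hcM : (W.card : ℝ) ≤ M := by
    exact_mod_cast (Finset.card_le_univ W).trans_eq (Fintype.card_fin M)
  have hM : (0 : ℝ) < M := by linarith
  have h1 : p i y / (2 * M) ≤ mixture W (smoothed p W) w y := by
    refine le_mixture hW hw fun j _ => ?_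
    rw [smoothed_eq]
    have h2 : p i y / M ≤ (∑ j ∈ W, p j y) / W.card :=
      div_le_div₀ (Finset.sum_nonneg fun j _ => hp j y)
        (Finset.single_le_sum (fun j _ => hp j y) hi) hc hcM
    have h3 : p i y / (2 * M) = 1 / 2 * (p i y / M) := by ring
    have := hp j y
    linarith
  rw [div_le_iff₀ (by positivity)] at h1
  linarith

variable [MeasurableSpace 𝒳] {μ : Measure 𝒳}

theorem isDensity_smoothed {p : Fin M → 𝒳 → ℝ} (hp : ∀ i, IsDensity μ (p i))
    {W : Finset (Fin M)} (hW : W.Nonempty) (i : Fin M) : IsDensity μ (smoothed p W i) := by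
  have := isDensity_convexComb (s := Finset.univ) (c := fun _ : Bool => (1 / 2 : ℝ))
    (q := fun b => bif b then p i else fun y => (∑ j ∈ W, p j y) / (W.card : ℝ))
    (by
      rintro (_ | _) _
      · exact isDensity_average hW fun j _ => hp j
      · exact hp i) (fun _ => by norm_num) (by norm_num)
  convert this using 2 with y
  simp [smoothed_eq]

theorem measurableSet_mem_almostMLE {p : Fin M → 𝒳 → ℝ} (hp : ∀ i, Measurable (p i)) (δ : ℝ)
    (m : ℕ) (i : Fin M) : MeasurableSet {x : ℕ → 𝒳 | i ∈ almostMLE p δ x m} := by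
  simp only [mem_almostMLE, Set.ofPred_forall]
  have h : ∀ j, Measurable fun x : ℕ → 𝒳 => ∏ k ∈ Finset.range m, p j (x k) := fun j =>
    Finset.measurable_prod _ fun k _ => (hp j).comp (measurable_pi_apply k)
  exact MeasurableSet.iInter fun j => measurableSet_le (h j) ((h i).const_mul _)

/-- `W` takes finitely many values, so it suffices to check measurability with the random class
frozen. -/
theorem measurable_comp_finset {α β : Type*} [MeasurableSpace α] [MeasurableSpace β]
    {W : α → Finset (Fin M)} (hW : ∀ i, MeasurableSet {a | i ∈ W a})
    {G : Finset (Fin M) → α → β} (hG : ∀ S, Measurable (G S)) :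
    Measurable fun a => G (W a) a := by
  let _ : MeasurableSpace (Finset (Fin M)) := ⊤
  have hWm : Measurable W := by
    refine measurable_to_countable' fun S => ?_
    have : W ⁻¹' {S} = ⋂ i, {a | i ∈ W a ↔ i ∈ S} := by
      ext a
      simp [Finset.ext_iff]
    rw [this]
    refine MeasurableSet.iInter fun i => ?_
    by_cases hi : i ∈ S
    · simpa [hi] using hW i
    · simp only [hi, iff_false]
      exact (hW i).compl
  have : Measurable fun z : α × Finset (Fin M) => G z.2 z.1 :=
    measurable_from_prod_countable_left hG
  exact this.comp (measurable_id.prodMk hWm)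

theorem measurable_smoothed {p : Fin M → 𝒳 → ℝ} (hp : ∀ i, Measurable (p i))
    (W : Finset (Fin M)) (i : Fin M) : Measurable (smoothed p W i) :=
  ((hp i).const_mul _).add ((Finset.measurable_sum _ fun j _ => hp j).const_mul _)

theorem isDensity_progressiveMixture {ι : Type*} {s : Finset ι} (hs : s.Nonempty)
    {q : ι → 𝒳 → ℝ} (hq : ∀ i, IsDensity μ (q i)) (x : ℕ → 𝒳) {m : ℕ} (hm : 0 < m) :
    IsDensity μ (progressiveMixture s q x m) := by
  have := isDensity_average (μ := μ) (s := Finset.range m)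
    (q := fun t => mixture s q (shiftedWeight s q x t))
    (Finset.nonempty_range_iff.2 hm.ne') fun t _ =>
      isDensity_mixture hs (fun i _ => hq i) (shiftedWeight_nonneg (fun i => (hq i).nonneg) x t)
  rwa [Finset.card_range] at this

theorem measurable_progressiveMixture {ι α : Type*} [MeasurableSpace α] (s : Finset ι)
    {q : ι → 𝒳 → ℝ} (hq : ∀ i, Measurable (q i)) {x : α → ℕ → 𝒳} (hx : Measurable x)
    {g : α → 𝒳} (hg : Measurable g) (m : ℕ) :
    Measurable fun a => progressiveMixture s q (x a) m (g a) :=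
  (Finset.measurable_sum _ fun t _ => measurable_mixture s hq
    (fun i => (measurable_shiftedWeight s hq t i).comp hx) hg).div_const _

theorem isDensityEstimator_aggregate {n : ℕ} [NeZero n] {p : Fin M → 𝒳 → ℝ}
    (hp : ∀ i, IsDensity μ (p i)) (hM : 2 ≤ M) {δ : ℝ} (hδ0 : 0 < δ) (hδ1 : δ < 1) :
    IsDensityEstimator μ (aggregate (n := n) p δ) := by
  have : Nonempty (Fin M) := ⟨⟨0, by omega⟩⟩
  by_cases hn : (n : ℝ) ≤ 75 * Real.log (2 / δ)
  · have h : aggregate (n := n) p δ = fun _ y => (∑ i, p i y) / (M : ℝ) := by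
      funext X
      rw [aggregate, if_pos hn]
    have hd := isDensity_average Finset.univ_nonempty fun i _ => hp i
    simp only [Finset.card_univ, Fintype.card_fin] at hd
    rw [h]
    exact ⟨hd.measurable.comp measurable_snd, fun _ => hd⟩
  · have h : aggregate (n := n) p δ = fun X =>
        progressiveMixture (almostMLE p δ (obs X) (n / 2))
          (smoothed p (almostMLE p δ (obs X) (n / 2))) (fun k => obs X (n / 2 + k))
          (n / 2) := by
      funext X
      rw [aggregate, if_neg hn]
    have hn2 : 0 < n / 2 := by
      have h1 : Real.log 2 ≤ Real.log (2 / δ) :=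
        Real.log_le_log two_pos (by rw [le_div_iff₀ hδ0]; linarith)
      have h2 := Real.log_two_gt_d9
      have : (2 : ℝ) < n := by linarith
      have : 2 < n := by exact_mod_cast this
      omega
    rw [h]
    refine ⟨?_, fun X => ?_⟩
    · refine measurable_comp_finset (W := fun z : (Fin n → 𝒳) × 𝒳 =>
        almostMLE p δ (obs z.1) (n / 2)) (G := fun W z => progressiveMixture W (smoothed p W)
          (fun k => obs z.1 (n / 2 + k)) (n / 2) z.2) (fun i => ?_) fun W => ?_
      · exact (measurable_obs.comp measurable_fst)
          (measurableSet_mem_almostMLE (fun i => (hp i).measurable) δ (n / 2) i)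
      · exact measurable_progressiveMixture W
          (measurable_smoothed (fun i => (hp i).measurable) W)
          (measurable_pi_lambda _ fun k =>
            (measurable_pi_apply _).comp (measurable_obs.comp measurable_fst))
          measurable_snd _
    · have hW := almostMLE_nonempty (fun i => (hp i).nonneg) hM hδ0 hδ1 (obs X) (n / 2)
      exact isDensity_progressiveMixture hW (isDensity_smoothed hp hW) _ hn2

end AlmostMLE

/-! ### Likelihood tests and Hellinger affinity -/

section Testing

variable {𝒳 : Type*} [MeasurableSpace 𝒳] {μ : Measure 𝒳} {p f q : 𝒳 → ℝ}

theorem IsDensity.kl_le_log (hp : IsDensity μ p) (hq : IsDensity μ q) {C : ℝ}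
    (hC : ∀ y, p y ≤ C * q y) : kl μ p q ≤ ENNReal.ofReal (Real.log C) := by
  have := hp.isProbabilityMeasure_law
  rw [hp.kl_eq hq hC]
  refine ENNReal.ofReal_le_ofReal ?_
  calc ∫ y, Real.log (p y / q y) ∂law μ p ≤ ∫ _, Real.log C ∂law μ p := by
        refine integral_mono_ae (hp.integrable_log_div hq hC) (integrable_const _) ?_
        filter_upwards [hp.ae_pos] with y hy
        have hq0 : 0 < q y := (hq.nonneg y).lt_of_ne fun h => by
          have := hC y; rw [← h] at this; linarith
        exact Real.log_le_log (div_pos hy hq0) ((div_le_iff₀ hq0).2 (hC y))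
    _ = Real.log C := by simp

theorem measurable_eval_comp {g : 𝒳 → ENNReal} (hg : Measurable g) (k : ℕ) :
    Measurable fun x : ℕ → 𝒳 => g (x k) :=
  hg.comp (measurable_pi_apply k)

/-- A density `f` rarely has a much larger likelihood than the true density `p`. -/
theorem IsDensity.sampleLaw_likelihood_lt_le (hp : IsDensity μ p) (hf : IsDensity μ f) {n : ℕ}
    [NeZero n] {m : ℕ} (hm : m ≤ n) {T : ℝ} (hT : 0 < T) :
    sampleLaw μ p n {X | T * ∏ k ∈ Finset.range m, p (obs X k) <
      ∏ k ∈ Finset.range m, f (obs X k)} ≤ ENNReal.ofReal (1 / T) := by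
  have := hp.isProbabilityMeasure_law
  refine le_trans (measure_mono_ae ?_) (measure_le_of_prod_adapted (law μ p)
    (fun k x => ENNReal.ofReal (f (x k) / p (x k)))
    (fun k => measurable_eval_comp (hf.measurable.div hp.measurable).ennreal_ofReal k)
    (fun k x x' h => by simp only [h k le_rfl]) m hm
    (fun k _ x => by simpa using hp.lintegral_div_law_le hf) hT)
  filter_upwards [ae_forall_obs (law μ p) hp.ae_pos] with X hX hlt
  change ENNReal.ofReal T ≤ _
  rw [← ENNReal.ofReal_prod_of_nonneg fun k _ => div_nonneg (hf.nonneg _) (hp.nonneg _)]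
  refine ENNReal.ofReal_le_ofReal ?_
  rw [Finset.prod_div_distrib, le_div_iff₀ (Finset.prod_pos fun k _ => hX k)]
  exact le_of_lt hlt

/-- A density `f` far from the true density `p` in Hellinger distance rarely has a comparable
likelihood. -/
theorem IsDensity.sampleLaw_likelihood_le_le (hp : IsDensity μ p) (hf : IsDensity μ f) {n : ℕ}
    [NeZero n] {m : ℕ} (hm : m ≤ n) {T ε : ℝ} (hT : 0 < T) (hε : Real.exp (m * ε) = T ^ 2)
    (hA : ∫ y, √(f y / p y) ∂law μ p ≤ Real.exp (-ε)) :
    sampleLaw μ p n {X | ∏ k ∈ Finset.range m, p (obs X k) ≤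
      T ^ 2 * ∏ k ∈ Finset.range m, f (obs X k)} ≤ ENNReal.ofReal (1 / T) := by
  have := hp.isProbabilityMeasure_law
  refine le_trans (measure_mono_ae ?_) (measure_le_of_prod_adapted (law μ p)
    (fun k x => ENNReal.ofReal (√(f (x k) / p (x k)) * Real.exp ε))
    (fun k => measurable_eval_comp
      ((hf.measurable.div hp.measurable).sqrt.mul_const _).ennreal_ofReal k)
    (fun k x x' h => by simp only [h k le_rfl]) m hm
    (fun k _ x => ?_) hT)
  · filter_upwards [ae_forall_obs (law μ p) hp.ae_pos] with X hX hle
    change ENNReal.ofReal T ≤ _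
    rw [← ENNReal.ofReal_prod_of_nonneg fun k _ => by positivity]
    refine ENNReal.ofReal_le_ofReal ?_
    have hpos : 0 < ∏ k ∈ Finset.range m, p (obs X k) := Finset.prod_pos fun k _ => hX k
    rw [Finset.prod_mul_distrib, Finset.prod_const, Finset.card_range, ← Real.exp_nat_mul, hε,
      ← Real.sqrt_prod _ fun k _ => div_nonneg (hf.nonneg _) (hp.nonneg _),
      Finset.prod_div_distrib]
    -- On the event the root of the likelihood ratio is at least `1/T`; multiplied by `e^{mε} = T²`
    -- it reaches `T`, while each normalized factor has mean at most `1`.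
    have hle' : (1 / T) ^ 2 ≤ (∏ k ∈ Finset.range m, f (obs X k)) /
        ∏ k ∈ Finset.range m, p (obs X k) := by
      rw [le_div_iff₀ hpos, div_pow, one_pow, div_mul_eq_mul_div, one_mul,
        div_le_iff₀' (by positivity)]
      exact hle
    calc T = 1 / T * T ^ 2 := by field_simp
      _ ≤ _ := mul_le_mul_of_nonneg_right (Real.le_sqrt_of_sq_le hle') (by positivity)
  · simp only [Function.update_self]
    rw [← ofReal_integral_eq_lintegral_ofReal ((hp.integrable_sqrt_div_law hf).mul_const _)
      (Filter.Eventually.of_forall fun y => by positivity), integral_mul_const]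
    refine ENNReal.ofReal_le_one.2 ?_
    calc _ ≤ Real.exp (-ε) * Real.exp ε := by gcongr
      _ = 1 := by rw [← Real.exp_add]; simp

/-- The Hellinger affinity of `p i` with the average of a class containing `p i`. -/
theorem affinity_average_ge {M : ℕ} {p : Fin M → 𝒳 → ℝ} (hp : ∀ i, IsDensity μ (p i))
    {W : Finset (Fin M)} {i : Fin M} (hi : i ∈ W) {ε : ℝ} (hε : 0 ≤ ε)
    (hA : ∀ j ∈ W, 1 - ε ≤ ∫ y, √(p j y / p i y) ∂law μ (p i)) :
    1 - (1 - 1 / M) * ε ≤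
      ∫ y, √((∑ j ∈ W, p j y) / (W.card : ℝ) / p i y) ∂law μ (p i) := by
  have := (hp i).isProbabilityMeasure_law
  have hW : W.Nonempty := ⟨i, hi⟩
  have hc : 0 < (W.card : ℝ) := by exact_mod_cast hW.card_pos
  have hcM : (W.card : ℝ) ≤ M := by
    exact_mod_cast (Finset.card_le_univ W).trans_eq (Fintype.card_fin M)
  -- Concavity of the square root, via Cauchy-Schwarz.
  have hpt : ∀ y, (∑ j ∈ W, √(p j y / p i y)) / W.card ≤
      √((∑ j ∈ W, p j y) / (W.card : ℝ) / p i y) := fun y => by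
    refine Real.le_sqrt_of_sq_le ?_
    have h1 := sq_sum_le_card_mul_sum_sq (s := W) (f := fun j => √(p j y / p i y))
    have h2 : ∑ j ∈ W, √(p j y / p i y) ^ 2 = (∑ j ∈ W, p j y) / p i y := by
      rw [Finset.sum_div]
      exact Finset.sum_congr rfl fun j _ =>
        Real.sq_sqrt (div_nonneg ((hp j).nonneg y) ((hp i).nonneg y))
    rw [h2] at h1
    rw [div_pow, div_le_iff₀ (by positivity)]
    refine h1.trans_eq ?_
    field_simp
  have hself : ∫ y, √(p i y / p i y) ∂law μ (p i) = 1 := by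
    rw [integral_congr_ae (g := fun _ => (1 : ℝ))]
    · simp
    · filter_upwards [(hp i).ae_pos] with y hy
      rw [div_self hy.ne', Real.sqrt_one]
  have hint : ∀ j ∈ W, Integrable (fun y => √(p j y / p i y)) (law μ (p i)) :=
    fun j _ => (hp i).integrable_sqrt_div_law (hp j)
  -- `p i` has affinity `1` with itself, so only `|W| - 1` terms lose `ε`. The factor `1 - 1/M`
  -- gained is used in `aggregation_bound_le`.
  have hsum : 1 + ((W.card : ℝ) - 1) * (1 - ε) ≤
      ∑ j ∈ W, ∫ y, √(p j y / p i y) ∂law μ (p i) := by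
    rw [← Finset.add_sum_erase W _ hi, hself]
    have := Finset.card_nsmul_le_sum (W.erase i)
      (fun j => ∫ y, √(p j y / p i y) ∂law μ (p i)) (1 - ε)
      fun j hj => hA j (Finset.mem_of_mem_erase hj)
    rw [Finset.card_erase_of_mem hi, nsmul_eq_mul, Nat.cast_sub hW.card_pos] at this
    push_cast at this
    linarith
  calc 1 - (1 - 1 / M) * ε ≤ 1 - (1 - 1 / W.card) * ε := by gcongr
    _ = (1 + ((W.card : ℝ) - 1) * (1 - ε)) / W.card := by field_simp; ring
    _ ≤ (∑ j ∈ W, ∫ y, √(p j y / p i y) ∂law μ (p i)) / W.card := by gcongr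
    _ = ∫ y, (∑ j ∈ W, √(p j y / p i y)) / W.card ∂law μ (p i) := by
        rw [integral_div, integral_finsetSum _ hint]
    _ ≤ _ := by
        refine integral_mono ((integrable_finsetSum _ hint).div_const _)
          ((hp i).integrable_sqrt_div_law (isDensity_average hW fun j _ => hp j)) hpt

end Testing

/-! ### Constants of the upper bound -/

section Numerics

theorem aggregation_bound_le {M n : ℕ} {δ : ℝ} (hM : 2 ≤ M) (hδ0 : 0 < δ) (hδ1 : δ < 1)
    (hn : 75 * Real.log (2 / δ) < n) :
    (4 / 3 * (2 * ((n / 2 : ℕ) * ((1 - 1 / M) * (2 * Real.log (4 * M / δ) / (n / 2 : ℕ)))) +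
      2 * Real.log M + (2 * Real.log (2 * M) + 5) * Real.log (2 / δ))) / (n / 2 : ℕ) ≤
      min (75 * Real.log (2 * M) * Real.log (2 / δ) / n) (Real.log M) := by
  have hM' : (2 : ℝ) ≤ M := by exact_mod_cast hM
  have hM0 : (0 : ℝ) < M := by linarith
  set l := Real.log M with hl
  set L' := Real.log (2 / δ) with hL'
  have hlo := Real.log_two_gt_d9
  have hhi := Real.log_two_lt_d9
  set c := Real.log 2 with hc
  have hL2 : c ≤ L' := Real.log_le_log two_pos (by rw [le_div_iff₀ hδ0]; linarith)
  have hl2 : c ≤ l := Real.log_le_log two_pos hM'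
  have e1 : Real.log (2 * M) = c + l := Real.log_mul two_ne_zero hM0.ne'
  have e2 : Real.log (4 * M / δ) = c + l + L' := by
    rw [show 4 * (M : ℝ) / δ = 2 * M * (2 / δ) by ring, Real.log_mul (by positivity)
      (by positivity), e1]
  have hn52 : (51 : ℝ) < n := by linarith
  have hn' : 52 ≤ n := by exact_mod_cast hn52
  have hm1 : 26 ≤ n / 2 := by omega
  have hm2 : n ≤ 2 * (n / 2) + 1 := by omega
  set m : ℝ := ((n / 2 : ℕ) : ℝ) with hm
  have hm1' : (26 : ℝ) ≤ m := by rw [hm]; exact_mod_cast hm1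
  have hm2' : (n : ℝ) ≤ 2 * m + 1 := by rw [hm]; exact_mod_cast hm2
  have hm0 : 0 < m := by linarith
  rw [e1, e2]
  obtain ⟨y, hy⟩ : ∃ y : ℝ, y = 1 / M := ⟨_, rfl⟩
  have hy0 : 0 < y := by rw [hy]; positivity
  have hy2 : y ≤ 1 / 2 := by rw [hy]; gcongr
  -- From `log M ≥ 2(M - 1)/(M + 1)`. It absorbs the terms in `L'` alone into `l * L'` with a small
  -- enough constant even at `M = 2`.
  have hly : 2 * (1 - y) ≤ l * (1 + y) := by
    have h := Real.le_log_one_add_of_nonneg (x := (M : ℝ) - 1) (by linarith)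
    rw [add_sub_cancel, div_le_iff₀ (by linarith)] at h
    have : (M : ℝ) * y = 1 := by rw [hy]; field_simp
    nlinarith
  rw [← hy]
  have hlL : 0 < l * L' := by
    have : 0 < l := by linarith
    have : 0 < L' := by linarith
    positivity
  have hmain : 4 / 3 * (2 * (m * ((1 - y) * (2 * (c + l + L') / m))) + 2 * l +
      (2 * (c + l) + 5) * L') ≤ 33 * (l * L') := by
    have e3 : m * ((1 - y) * (2 * (c + l + L') / m)) = (1 - y) * (2 * (c + l + L')) := by
      field_simp
    rw [e3]
    have hl0 : 0 ≤ l := by linarith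
    have hL0 : 0 ≤ L' := by linarith
    have hl1 : l ≤ 1.443 * (l * L') := by
      nlinarith [mul_le_mul_of_nonneg_left hL2 hl0]
    have hL1 : L' ≤ 1.443 * (l * L') := by
      nlinarith [mul_le_mul_of_nonneg_right hl2 hL0]
    have h1 : (1 - y) * l ≤ (1 - y) * (1.443 * (l * L')) :=
      mul_le_mul_of_nonneg_left hl1 (by linarith)
    have h2 : 2 * ((1 - y) * L') ≤ l * (1 + y) * L' := by
      nlinarith [mul_le_mul_of_nonneg_right hly hL0]
    have h3 : (1 - y) * c ≤ (1 - y) * L' := mul_le_mul_of_nonneg_left hL2 (by linarith)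
    have h4 : c * L' ≤ l * L' := mul_le_mul_of_nonneg_right hl2 hL0
    linarith [mul_nonneg hy0.le hlL.le]
  rw [div_le_iff₀ hm0]
  -- What remains is `33n ≤ 75m`, from `n ≤ 2m + 1`, and `33L' ≤ m`, from `n > 75L'`.
  refine hmain.trans ?_
  rw [min_mul_of_nonneg _ _ hm0.le, le_min_iff]
  constructor
  · rw [div_mul_eq_mul_div, le_div_iff₀ (by linarith)]
    have : 33 * (n : ℝ) ≤ 75 * m := by linarith
    calc 33 * (l * L') * n = l * L' * (33 * n) := by ring
      _ ≤ l * L' * (75 * m) := by gcongr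
      _ ≤ _ := by
        have : 0 ≤ c * L' * m := by
          have : 0 < L' := by linarith
          positivity
        nlinarith
  · have : 33 * L' ≤ m := by linarith
    have hl0 : 0 ≤ l := by linarith
    nlinarith

end Numerics

/-! ### The exponential supermartingale -/

section Martingale

variable {𝒳 ι : Type*} [MeasurableSpace 𝒳] {μ : Measure 𝒳}

/-- The factor contributed by the observation `x t` to the exponential supermartingale that
compares the shifted progressive mixture with the element `q i` of the class, under the true
density `p`. -/
def shiftedFactor (μ : Measure 𝒳) (s : Finset ι) (q : ι → 𝒳 → ℝ) (p : 𝒳 → ℝ) (i : ι)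
    (γ h : ℝ) (x : ℕ → 𝒳) (t : ℕ) : ℝ :=
  (2 * mixture s q (shiftedWeight s q x t) (x t) /
      (q i (x t) + mixture s q (shiftedWeight s q x t) (x t))) ^ (2 * γ) *
    Real.exp (γ * (3 / 4 *
      ∫ y, Real.log (p y / mixture s q (shiftedWeight s q x t) y) ∂law μ p - 2 * h))

theorem measurable_shiftedFactor {s : Finset ι} {q : ι → 𝒳 → ℝ} (hq : ∀ i, Measurable (q i))
    {p : 𝒳 → ℝ} (hp : IsDensity μ p) (i : ι) (γ h : ℝ) (t : ℕ) :
    Measurable fun x => shiftedFactor μ s q p i γ h x t := by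
  have := hp.isProbabilityMeasure_law
  have h1 : Measurable fun x : ℕ → 𝒳 => mixture s q (shiftedWeight s q x t) (x t) :=
    measurable_mixture s hq (measurable_shiftedWeight s hq t) (measurable_pi_apply t)
  have h2 : Measurable fun z : (ℕ → 𝒳) × 𝒳 =>
      Real.log (p z.2 / mixture s q (shiftedWeight s q z.1 t) z.2) :=
    ((hp.measurable.comp measurable_snd).div (measurable_mixture s hq
      (fun i => (measurable_shiftedWeight s hq t i).comp measurable_fst) measurable_snd)).log
  have h3 : Measurable fun x : ℕ → 𝒳 =>
      ∫ y, Real.log (p y / mixture s q (shiftedWeight s q x t) y) ∂law μ p :=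
    (h2.stronglyMeasurable.integral_prod_right (ν := law μ p)).measurable
  exact (((h1.const_mul _).div (((hq i).comp (measurable_pi_apply t)).add h1)).pow_const _).mul
    (((h3.const_mul _).sub_const _).const_mul _).exp

theorem shiftedFactor_congr (s : Finset ι) (q : ι → 𝒳 → ℝ) (p : 𝒳 → ℝ) (i : ι) (γ h : ℝ)
    {x x' : ℕ → 𝒳} {t : ℕ} (hx : ∀ k ≤ t, x k = x' k) :
    shiftedFactor μ s q p i γ h x t = shiftedFactor μ s q p i γ h x' t := by
  rw [shiftedFactor, shiftedFactor, hx t le_rfl,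
    shiftedWeight_congr s q fun k hk => hx k hk.le]

variable {M : ℕ} {p : Fin M → 𝒳 → ℝ} {W : Finset (Fin M)} {i : Fin M}

theorem lintegral_shiftedFactor_update_le (hp : ∀ i, IsDensity μ (p i)) (hM : 2 ≤ M)
    (hi : i ∈ W) {γ h : ℝ}
    (hh : 1 - h ≤ ∫ y, √((∑ j ∈ W, p j y) / (W.card : ℝ) / p i y) ∂law μ (p i))
    (hγ : γ = 1 / (2 * Real.log (2 * M) + 5)) (x : ℕ → 𝒳) (t : ℕ) :
    ∫⁻ y, ENNReal.ofReal (shiftedFactor μ W (smoothed p W) (p i) i γ h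
      (Function.update x t y) t) ∂law μ (p i) ≤ 1 := by
  have hW : W.Nonempty := ⟨i, hi⟩
  have hw : ∀ j, 0 ≤ shiftedWeight W (smoothed p W) x t j :=
    shiftedWeight_nonneg (smoothed_nonneg (fun i => (hp i).nonneg) W) x t
  have hr := isDensity_mixture hW (fun j _ => isDensity_smoothed hp hW j) hw
  have hK : 1 ≤ Real.log (2 * M) := by
    have hM' : (2 : ℝ) ≤ M := by exact_mod_cast hM
    have h1 : Real.log (2 ^ 2) ≤ Real.log (2 * M) := Real.log_le_log (by norm_num) (by linarith)
    rw [Real.log_pow] at h1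
    have := Real.log_two_gt_d9
    push_cast at h1
    linarith
  have key := (hp i).lintegral_shifted_ratio_le hr (isDensity_average hW fun j _ => hp j)
    (smoothed_eq p W i) hK (le_mul_mixture_smoothed (fun i => (hp i).nonneg) hi hw) hh hγ
  have hup : ∀ y, shiftedWeight W (smoothed p W) (Function.update x t y) t =
      shiftedWeight W (smoothed p W) x t := fun y =>
    shiftedWeight_congr _ _ fun k hk => Function.update_of_ne (by omega) _ _
  simp only [shiftedFactor, hup, Function.update_self]
  simp_rw [ENNReal.ofReal_mul' (Real.exp_nonneg _)]
  rw [lintegral_mul_const' _ _ ENNReal.ofReal_ne_top]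
  refine (mul_le_mul_left key _).trans ?_
  rw [← ENNReal.ofReal_mul (Real.exp_nonneg _), ← Real.exp_add]
  simp

/-- A bound on the supermartingale turns into a bound on the divergence of the progressive
mixture. -/
theorem kl_progressiveMixture_le (hp : ∀ i, IsDensity μ (p i)) (hi : i ∈ W) {γ h δ : ℝ}
    (hγ : 0 < γ) {x : ℕ → 𝒳} {m : ℕ} (hm : 0 < m)
    (hx : ∀ k, 0 < p i (x k))
    (hlt : ∏ t ∈ Finset.range m, shiftedFactor μ W (smoothed p W) (p i) i γ h x t < 2 / δ) :
    kl μ (p i) (progressiveMixture W (smoothed p W) x m) ≤ ENNReal.ofReal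
      ((4 / 3 * (2 * (m * h) + 2 * Real.log M + 1 / γ * Real.log (2 / δ))) / m) := by
  have hW : W.Nonempty := ⟨i, hi⟩
  have hc : 0 < (W.card : ℝ) := by exact_mod_cast hW.card_pos
  have hcM : (W.card : ℝ) ≤ M := by
    exact_mod_cast (Finset.card_le_univ W).trans_eq (Fintype.card_fin M)
  have hM : (0 : ℝ) < M := by linarith
  have hm0 : (0 : ℝ) < m := by exact_mod_cast hm
  have hq0 := smoothed_nonneg (fun i => (hp i).nonneg) W
  have hw : ∀ t j, 0 ≤ shiftedWeight W (smoothed p W) x t j := fun t =>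
    shiftedWeight_nonneg hq0 x t
  set r : ℕ → 𝒳 → ℝ := fun t => mixture W (smoothed p W) (shiftedWeight W (smoothed p W) x t)
    with hr
  have hrd : ∀ t, IsDensity μ (r t) := fun t =>
    isDensity_mixture hW (fun j _ => isDensity_smoothed hp hW j) (hw t)
  have hdom : ∀ t y, p i y ≤ 2 * M * r t y := fun t =>
    le_mul_mixture_smoothed (fun i => (hp i).nonneg) hi (hw t)
  have hrpos : ∀ t y, 0 < p i y → 0 < r t y := fun t y hy => by
    have := hy.trans_le (hdom t y)
    exact pos_of_mul_pos_right this (by positivity)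
  set D : ℕ → ℝ := fun t => ∫ y, Real.log (p i y / r t y) ∂law μ (p i) with hD
  set R : ℕ → ℝ := fun t => 2 * r t (x t) / (smoothed p W i (x t) + r t (x t)) with hR
  have hRpos : ∀ t, 0 < R t := fun t => by
    have h1 := hrpos t _ (hx t)
    have h2 := hq0 i (x t)
    simp only [hR]
    positivity
  have hregret : 1 / (M : ℝ) ≤ ∏ t ∈ Finset.range m, R t := by
    have h1 := prod_shifted_le_card_mul_prod hq0 x m hi
    have h2 : 0 < ∏ t ∈ Finset.range m, (1 / 2 * smoothed p W i (x t) + 1 / 2 * r t (x t)) :=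
      Finset.prod_pos fun t _ => by
        have h1 := hrpos t _ (hx t)
        have h2 := hq0 i (x t)
        positivity
    have h3 : ∏ t ∈ Finset.range m, R t = (∏ t ∈ Finset.range m, r t (x t)) /
        ∏ t ∈ Finset.range m, (1 / 2 * smoothed p W i (x t) + 1 / 2 * r t (x t)) := by
      rw [← Finset.prod_div_distrib]
      refine Finset.prod_congr rfl fun t _ => ?_
      have h1 := hrpos t _ (hx t)
      have h2 := hq0 i (x t)
      simp only [hR]
      rw [div_eq_div_iff (by positivity) (by positivity)]
      ring
    rw [h3, div_le_div_iff₀ hM h2, one_mul]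
    refine h1.trans ?_
    rw [mul_comm]
    exact mul_le_mul_of_nonneg_left hcM
      (Finset.prod_nonneg fun t _ => (hrpos t _ (hx t)).le)
  have hprod : ∏ t ∈ Finset.range m, shiftedFactor μ W (smoothed p W) (p i) i γ h x t =
      (∏ t ∈ Finset.range m, R t) ^ (2 * γ) *
        Real.exp (γ * (3 / 4 * ∑ t ∈ Finset.range m, D t - 2 * (m * h))) := by
    have : ∀ t, shiftedFactor μ W (smoothed p W) (p i) i γ h x t =
        R t ^ (2 * γ) * Real.exp (γ * (3 / 4 * D t - 2 * h)) := fun t => rfl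
    simp only [this]
    rw [Finset.prod_mul_distrib, Real.finsetProd_rpow _ _ fun t _ => (hRpos t).le,
      ← Real.exp_sum, ← Finset.mul_sum, Finset.sum_sub_distrib, ← Finset.mul_sum,
      Finset.sum_const, Finset.card_range, nsmul_eq_mul]
    ring_nf
  -- Logarithm of the supermartingale bound: the ratios contribute at least `-2γ log M` by
  -- `hregret`, and dividing by `γ` isolates the divergences.
  have hsum : ∑ t ∈ Finset.range m, D t ≤
      4 / 3 * (2 * (m * h) + 2 * Real.log M + 1 / γ * Real.log (2 / δ)) := by
    have hRp : 0 < ∏ t ∈ Finset.range m, R t := Finset.prod_pos fun t _ => hRpos t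
    have h1 := Real.log_lt_log (by rw [hprod]; positivity) hlt
    rw [hprod, Real.log_mul (by positivity) (by positivity), Real.log_rpow hRp,
      Real.log_exp] at h1
    have h2 := Real.log_le_log (by positivity) hregret
    rw [one_div, Real.log_inv] at h2
    have h3 : γ * (3 / 4 * ∑ t ∈ Finset.range m, D t - 2 * (m * h) - 2 * Real.log M) ≤
        Real.log (2 / δ) := by
      have := mul_le_mul_of_nonneg_left h2 (by positivity : 0 ≤ 2 * γ)
      linarith
    rw [← le_div_iff₀' hγ] at h3
    have h4 : Real.log (2 / δ) / γ = 1 / γ * Real.log (2 / δ) := by ring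
    linarith
  have hdomP : ∀ y, p i y ≤ 2 * M * progressiveMixture W (smoothed p W) x m y := fun y => by
    rw [progressiveMixture, ← mul_div_assoc, le_div_iff₀ hm0, Finset.mul_sum]
    have := Finset.card_nsmul_le_sum (Finset.range m) (fun t => 2 * M * r t y) (p i y)
      fun t _ => hdom t y
    rw [Finset.card_range, nsmul_eq_mul] at this
    linarith
  have hPd := isDensity_progressiveMixture hW (isDensity_smoothed hp hW) x hm
  rw [(hp i).kl_eq hPd hdomP]
  refine ENNReal.ofReal_le_ofReal (le_trans ?_ (div_le_div_of_nonneg_right hsum hm0.le))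
  have hint : ∀ t ∈ Finset.range m,
      Integrable (fun y => Real.log (p i y / r t y)) (law μ (p i)) :=
    fun t _ => (hp i).integrable_log_div (hrd t) (hdom t)
  rw [hD, ← integral_finsetSum _ hint, ← integral_div]
  refine integral_mono_ae ((hp i).integrable_log_div hPd hdomP)
    ((integrable_finsetSum _ hint).div_const _) ?_
  filter_upwards [(hp i).ae_pos] with y hy
  -- Jensen, pointwise: the log-loss of the average is at most the average log-loss.
  have hconc := strictConcaveOn_log_Ioi.concaveOn.le_map_sum (t := Finset.range m)
    (w := fun _ => 1 / (m : ℝ)) (p := fun t => r t y) (fun _ _ => by positivity)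
    (by simp [hm0.ne']) fun t _ => hrpos t y hy
  simp only [smul_eq_mul, ← Finset.mul_sum] at hconc
  have hpm : progressiveMixture W (smoothed p W) x m y =
      1 / m * ∑ t ∈ Finset.range m, r t y := by
    rw [progressiveMixture]; ring
  have hPpos : 0 < progressiveMixture W (smoothed p W) x m y := by
    have := hy.trans_le (hdomP y)
    exact pos_of_mul_pos_right this (by positivity)
  rw [← hpm] at hconc
  rw [Real.log_div hy.ne' hPpos.ne', Finset.sum_congr rfl fun t _ =>
    Real.log_div hy.ne' (hrpos t y hy).ne', Finset.sum_sub_distrib, Finset.sum_const,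
    Finset.card_range, nsmul_eq_mul, sub_div, mul_div_cancel_left₀ _ hm0.ne']
  have : 1 / (m : ℝ) * ∑ t ∈ Finset.range m, Real.log (r t y) =
    (∑ t ∈ Finset.range m, Real.log (r t y)) / m := by ring
  linarith

end Martingale

/-! ### The high-probability upper bound -/

section UpperBound

variable {𝒳 : Type*} [MeasurableSpace 𝒳] {μ : Measure 𝒳} {M : ℕ} {p : Fin M → 𝒳 → ℝ}

/-- Subadditivity alone is used, so the event `S` need not be shown measurable. -/
theorem one_sub_le_measure_of_compl_le {α : Type*} [MeasurableSpace α] (Q : Measure α)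
    [IsProbabilityMeasure Q] {S : Set α} {δ : ℝ} (hδ : 0 ≤ δ)
    (h : Q Sᶜ ≤ ENNReal.ofReal δ) : ENNReal.ofReal (1 - δ) ≤ Q S := by
  rw [ENNReal.ofReal_sub _ hδ, ENNReal.ofReal_one, tsub_le_iff_right]
  calc 1 = Q (S ∪ Sᶜ) := by rw [Set.union_compl_self, measure_univ]
    _ ≤ Q S + Q Sᶜ := measure_union_le _ _
    _ ≤ _ := by gcongr

/-- The class `W` contains the true density `p i`, and all its elements have Hellinger affinity
at least `1 - ε` with it. -/
def IsLocalizedAt (μ : Measure 𝒳) (p : Fin M → 𝒳 → ℝ) (i : Fin M) (ε : ℝ)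
    (W : Finset (Fin M)) : Prop :=
  i ∈ W ∧ ∀ j ∈ W, 1 - ε ≤ ∫ y, √(p j y / p i y) ∂law μ (p i)

/-- Union bound over `j`: with `T = 4M/δ`, excluding the true index costs `1/T²` and keeping a far
density costs `1/T`; in total at most `2M/T = δ/2`. -/
theorem measure_not_isLocalizedAt_le (hp : ∀ i, IsDensity μ (p i)) (i : Fin M) {n : ℕ}
    [NeZero n] {m : ℕ} (hm : m ≤ n) (hm0 : 0 < m) (hM : 2 ≤ M) {δ : ℝ} (hδ0 : 0 < δ)
    (hδ1 : δ < 1) :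
    sampleLaw μ (p i) n {X | ¬ IsLocalizedAt μ p i (2 * Real.log (4 * M / δ) / m)
      (almostMLE p δ (obs X) m)} ≤ ENNReal.ofReal (δ / 2) := by
  have hM' : (2 : ℝ) ≤ M := by exact_mod_cast hM
  set T : ℝ := 4 * M / δ with hT
  have hT0 : 0 < T := by positivity
  set ε : ℝ := 2 * Real.log T / m with hε
  have hexp : Real.exp (m * ε) = T ^ 2 := by
    have : (m : ℝ) * ε = 2 * Real.log T := by
      rw [hε]; field_simp
    rw [this, mul_comm, Real.exp_mul, Real.exp_log hT0, Real.rpow_two]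
  set A : Fin M → Set (Fin n → 𝒳) := fun j => {X | T ^ 2 * ∏ k ∈ Finset.range m, p i (obs X k) <
    ∏ k ∈ Finset.range m, p j (obs X k)}
  set B : Fin M → Set (Fin n → 𝒳) := fun j => {X | j ∈ almostMLE p δ (obs X) m ∧
    ∫ y, √(p j y / p i y) ∂law μ (p i) < 1 - ε}
  have hsub : {X | ¬ IsLocalizedAt μ p i ε (almostMLE p δ (obs X) m)} ⊆
      ⋃ j, (A j ∪ B j) := by
    intro X hX
    change ¬ IsLocalizedAt μ p i ε (almostMLE p δ (obs X) m) at hX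
    simp only [IsLocalizedAt, not_and_or, mem_almostMLE, not_forall, not_le] at hX
    rw [Set.mem_iUnion]
    rcases hX with ⟨j, hj⟩ | ⟨j, hj, hj'⟩
    · exact ⟨j, Or.inl hj⟩
    · exact ⟨j, Or.inr ⟨mem_almostMLE.2 hj, hj'⟩⟩
  have hA : ∀ j, sampleLaw μ (p i) n (A j) ≤ ENNReal.ofReal (1 / T ^ 2) := fun j =>
    (hp i).sampleLaw_likelihood_lt_le (hp j) hm (by positivity)
  have hB : ∀ j, sampleLaw μ (p i) n (B j) ≤ ENNReal.ofReal (1 / T) := fun j => by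
    by_cases hj : ∫ y, √(p j y / p i y) ∂law μ (p i) < 1 - ε
    · refine le_trans (measure_mono ?_)
        ((hp i).sampleLaw_likelihood_le_le (hp j) hm hT0 hexp ?_)
      · exact fun X hX => mem_almostMLE.1 hX.1 i
      · have := Real.add_one_le_exp (-ε)
        linarith
    · have : B j = ∅ := Set.eq_empty_of_forall_notMem fun X hX => hj hX.2
      rw [this, measure_empty]
      exact zero_le
  refine (measure_mono hsub).trans ((measure_iUnion_fintype_le _ _).trans ?_)
  calc ∑ j, sampleLaw μ (p i) n (A j ∪ B j)
      ≤ ∑ _j : Fin M, ENNReal.ofReal (1 / T ^ 2 + 1 / T) := Finset.sum_le_sum fun j _ => by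
        rw [ENNReal.ofReal_add (by positivity) (by positivity)]
        exact (measure_union_le _ _).trans (add_le_add (hA j) (hB j))
    _ = ENNReal.ofReal (M * (1 / T ^ 2 + 1 / T)) := by
        rw [Finset.sum_const, Finset.card_univ, Fintype.card_fin, nsmul_eq_mul,
          ENNReal.ofReal_mul (Nat.cast_nonneg _), ENNReal.ofReal_natCast]
    _ ≤ ENNReal.ofReal (δ / 2) := by
        refine ENNReal.ofReal_le_ofReal ?_
        have h1 : M * (1 / T) = δ / 4 := by rw [hT]; field_simp
        have h2 : 1 / T ^ 2 ≤ 1 / T := by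
          have : 1 ≤ T := by rw [hT, le_div_iff₀ hδ0]; linarith
          exact one_div_le_one_div_of_le hT0 (by nlinarith)
        have h3 := mul_le_mul_of_nonneg_left h2 (by linarith : (0 : ℝ) ≤ M)
        linarith

theorem sampleLaw_kl_aggregate_ge (hp : ∀ i, IsDensity μ (p i)) (i : Fin M) {n : ℕ} [NeZero n]
    (hM : 2 ≤ M) {δ : ℝ} (hδ0 : 0 < δ) (hδ1 : δ < 1) :
    ENNReal.ofReal (1 - δ) ≤ sampleLaw μ (p i) n
      {X | kl μ (p i) (aggregate p δ X) ≤ ENNReal.ofReal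
        (min (75 * Real.log (2 * M) * Real.log (2 / δ) / n) (Real.log M))} := by
  classical
  have hM' : (2 : ℝ) ≤ M := by exact_mod_cast hM
  have hne : Nonempty (Fin M) := ⟨i⟩
  have hn0 : (0 : ℝ) < n := by exact_mod_cast Nat.pos_of_neZero n
  have := (hp i).isProbabilityMeasure_law
  have : IsProbabilityMeasure (sampleLaw μ (p i) n) := by
    rw [sampleLaw]; infer_instance
  refine one_sub_le_measure_of_compl_le _ hδ0.le ?_
  have hL0 : 0 < Real.log (2 / δ) := Real.log_pos (by rw [lt_div_iff₀ hδ0]; linarith)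
  have hLM : Real.log M ≤ Real.log (2 * M) := Real.log_le_log (by linarith) (by linarith)
  -- For small `n` the first term of the minimum is at least `log(2M)`, and the uniform mixture
  -- achieves `log M` on every sample because it dominates `p i / M`.
  by_cases hn : (n : ℝ) ≤ 75 * Real.log (2 / δ)
  · have hmin : min (75 * Real.log (2 * M) * Real.log (2 / δ) / n) (Real.log M) =
        Real.log M := by
      refine min_eq_right (hLM.trans ?_)
      rw [le_div_iff₀ hn0]
      have : 0 ≤ Real.log (2 * M) := Real.log_nonneg (by linarith)
      nlinarith
    rw [hmin]
    have hd := isDensity_average Finset.univ_nonempty fun i _ => hp i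
    simp only [Finset.card_univ, Fintype.card_fin] at hd
    have hall : ∀ X : Fin n → 𝒳, kl μ (p i) (aggregate p δ X) ≤
        ENNReal.ofReal (Real.log M) := fun X => by
      have h : aggregate p δ X = fun y => (∑ i, p i y) / (M : ℝ) := by
        rw [aggregate, if_pos hn]
      rw [h]
      refine (hp i).kl_le_log hd fun y => ?_
      rw [mul_div_cancel₀ _ (by linarith : (M : ℝ) ≠ 0)]
      exact Finset.single_le_sum (fun j _ => (hp j).nonneg y) (Finset.mem_univ i)
    refine (measure_mono (t := ∅) fun X hX => (hX (hall X)).elim).trans ?_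
    simp
  · have hnum := aggregation_bound_le hM hδ0 hδ1 (not_le.1 hn)
    set m := n / 2 with hm
    have hm0 : 0 < m := by
      have h1 : Real.log 2 ≤ Real.log (2 / δ) :=
        Real.log_le_log two_pos (by rw [le_div_iff₀ hδ0]; linarith)
      have h2 := Real.log_two_gt_d9
      have : (2 : ℝ) < n := by linarith
      have : 2 < n := by exact_mod_cast this
      omega
    set ε : ℝ := 2 * Real.log (4 * M / δ) / m with hε
    have hε0 : 0 ≤ ε := by
      have : 0 ≤ Real.log (4 * M / δ) :=
        Real.log_nonneg (by rw [le_div_iff₀ hδ0]; linarith)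
      positivity
    set h : ℝ := (1 - 1 / M) * ε with hh
    set γ : ℝ := 1 / (2 * Real.log (2 * M) + 5) with hγ
    have hγ0 : 0 < γ := by
      have : 0 ≤ Real.log (2 * M) := Real.log_nonneg (by linarith)
      positivity
    -- The factor is set to `1` when `W` is not localized, and in `Φ` during the first `m`
    -- observations, so the conditional mean is at most `1` for every past. `W` depends only on the
    -- first `m` observations and is therefore fixed when the factors of the second half are
    -- integrated.
    let G : ℕ → Finset (Fin M) → (ℕ → 𝒳) → ENNReal := fun t W x =>
      if IsLocalizedAt μ p i ε W then
        ENNReal.ofReal (shiftedFactor μ W (smoothed p W) (p i) i γ h (fun k => x (m + k)) t)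
      else 1
    let Φ : ℕ → (ℕ → 𝒳) → ENNReal := fun k x =>
      if k < m then 1 else G (k - m) (almostMLE p δ x m) x
    have hshift : Measurable fun (x : ℕ → 𝒳) k => x (m + k) :=
      measurable_pi_lambda _ fun k => measurable_pi_apply _
    have hΦ : ∀ k, Measurable (Φ k) := fun k => by
      by_cases hk : k < m
      · simp only [Φ, if_pos hk]; exact measurable_const
      · simp only [Φ, if_neg hk]
        refine measurable_comp_finset (W := fun x => almostMLE p δ x m) (G := G (k - m))
          (measurableSet_mem_almostMLE (fun i => (hp i).measurable) δ m) fun W => ?_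
        by_cases hW : IsLocalizedAt μ p i ε W
        · simp only [G, if_pos hW]
          exact ((measurable_shiftedFactor
            (measurable_smoothed (fun i => (hp i).measurable) W) (hp i) i γ h _).comp
              hshift).ennreal_ofReal
        · simp only [G, if_neg hW]; exact measurable_const
    have hdep : ∀ k x x', (∀ i ≤ k, x i = x' i) → Φ k x = Φ k x' := fun k x x' hx => by
      by_cases hk : k < m
      · simp only [Φ, if_pos hk]
      · simp only [Φ, if_neg hk, G]
        rw [almostMLE_congr p δ (x := x) (x' := x') fun l hl => hx l (by omega),
          shiftedFactor_congr (x' := fun k => x' (m + k)) _ _ _ _ _ _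
            fun l hl => hx (m + l) (by omega)]
    have hint : ∀ k < m + m, ∀ x, ∫⁻ y, Φ k (Function.update x k y) ∂law μ (p i) ≤ 1 := by
      intro k _ x
      by_cases hk : k < m
      · simp [Φ, if_pos hk]
      · have hW : ∀ y, almostMLE p δ (Function.update x k y) m = almostMLE p δ x m := fun y =>
          almostMLE_congr p δ fun l hl => Function.update_of_ne (by omega) _ _
        simp only [Φ, if_neg hk, G, hW]
        by_cases hloc : IsLocalizedAt μ p i ε (almostMLE p δ x m)
        · simp only [if_pos hloc]
          have hup : ∀ y, (fun l => Function.update x k y (m + l)) =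
              Function.update (fun l => x (m + l)) (k - m) y := fun y => by
            funext l
            by_cases hl : l = k - m
            · subst hl
              rw [Function.update_self, show m + (k - m) = k by omega, Function.update_self]
            · rw [Function.update_of_ne hl, Function.update_of_ne (by omega)]
          simp only [hup]
          exact lintegral_shiftedFactor_update_le hp hM hloc.1
            (affinity_average_ge hp hloc.1 hε0 hloc.2) hγ _ _
        · simp [if_neg hloc]
    have hmart := measure_le_of_prod_adapted (n := n) (law μ (p i)) Φ hΦ hdep (m + m)
      (by omega) hint (T := 2 / δ) (by positivity)
    have hloc := measure_not_isLocalizedAt_le hp i (n := n) (m := m) (by omega) hm0 hM hδ0 hδ1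
    calc sampleLaw μ (p i) n _
        ≤ sampleLaw μ (p i) n ({X | ¬ IsLocalizedAt μ p i ε (almostMLE p δ (obs X) m)} ∪
            {X | ENNReal.ofReal (2 / δ) ≤ ∏ k ∈ Finset.range (m + m), Φ k (obs X)}) := by
          refine measure_mono_ae ?_
          filter_upwards [ae_forall_obs (n := n) (law μ (p i)) (hp i).ae_pos] with X hX hkl
          change _ ∨ _
          by_contra hcon
          simp only [not_or, Set.mem_ofPred_eq, not_not, not_le] at hcon
          obtain ⟨hl, hlt⟩ := hcon
          refine hkl ?_
          change kl μ (p i) (aggregate p δ X) ≤ _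
          have hagg : aggregate p δ X = progressiveMixture (almostMLE p δ (obs X) m)
              (smoothed p (almostMLE p δ (obs X) m)) (fun k => obs X (m + k)) m := by
            rw [aggregate, if_neg hn]
          have hfac : ∀ t, 0 ≤ shiftedFactor μ (almostMLE p δ (obs X) m)
              (smoothed p (almostMLE p δ (obs X) m)) (p i) i γ h
              (fun k => obs X (m + k)) t := fun t => by
            have h1 := smoothed_nonneg (fun i => (hp i).nonneg) (almostMLE p δ (obs X) m)
            have h2 := mixture_nonneg (s := almostMLE p δ (obs X) m)
              (shiftedWeight_nonneg (s := almostMLE p δ (obs X) m) h1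
                (fun k => obs X (m + k)) t)
              (fun j => h1 j (obs X (m + t)))
            have h3 := h1 i (obs X (m + t))
            rw [shiftedFactor]
            exact mul_nonneg (Real.rpow_nonneg (by positivity) _) (Real.exp_nonneg _)
          have hlt' : ∏ t ∈ Finset.range m, shiftedFactor μ (almostMLE p δ (obs X) m)
              (smoothed p (almostMLE p δ (obs X) m)) (p i) i γ h
              (fun k => obs X (m + k)) t < 2 / δ := by
            rw [Finset.prod_range_add, Finset.prod_congr rfl (g := fun _ => 1)
              fun k hk => if_pos (Finset.mem_range.1 hk)] at hlt
            simp only [Finset.prod_const_one, one_mul, Φ, G, if_pos hl,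
              Nat.add_sub_cancel_left, if_neg (not_lt.2 (Nat.le_add_right m _))] at hlt
            rw [← ENNReal.ofReal_prod_of_nonneg fun t _ => hfac t] at hlt
            exact (ENNReal.ofReal_lt_ofReal_iff (by positivity)).1 hlt
          have hkey := kl_progressiveMixture_le hp hl.1 hγ0 hm0 (fun k => hX (m + k)) hlt'
          rw [hagg]
          refine hkey.trans (ENNReal.ofReal_le_ofReal (le_trans (le_of_eq ?_) hnum))
          rw [hγ, one_div_one_div]
    _ ≤ ENNReal.ofReal (δ / 2) + ENNReal.ofReal (1 / (2 / δ)) :=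
          (measure_union_le _ _).trans (add_le_add hloc hmart)
    _ = ENNReal.ofReal δ := by
          rw [← ENNReal.ofReal_add (by positivity) (by positivity), one_div_div, add_halves]

end UpperBound

/-! ### Lower bound: a common atom and private spikes -/

section LowerBound

variable {𝒴 : Type*} [MeasurableSpace 𝒴] [DiscreteMeasurableSpace 𝒴]

theorem law_count_singleton (p : 𝒴 → ℝ) (y : 𝒴) :
    law Measure.count p {y} = ENNReal.ofReal (p y) := by
  rw [law, withDensity_apply _ (measurableSet_singleton y), lintegral_singleton,
    Measure.count_singleton, mul_one]

theorem kl_count_eq_top {p q : 𝒴 → ℝ} {y : 𝒴} (hp : 0 < p y) (hq : q y = 0) :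
    kl Measure.count p q = ⊤ := by
  refine klDiv_of_not_ac fun hac => ?_
  have h := hac (s := {y}) (by rw [law_count_singleton, hq, ENNReal.ofReal_zero])
  rw [law_count_singleton, ENNReal.ofReal_eq_zero] at h
  linarith

/-- The density on `Option (Fin M)` with mass `1 - e` at `none` and `e` at `some i`. -/
def spike {M : ℕ} (e : ℝ) (i : Fin M) : Option (Fin M) → ℝ
  | none => 1 - e
  | some j => if j = i then e else 0

variable {M : ℕ} [MeasurableSpace (Option (Fin M))] [DiscreteMeasurableSpace (Option (Fin M))]

theorem isDensity_spike {e : ℝ} (he0 : 0 ≤ e) (he1 : e ≤ 1) (i : Fin M) :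
    IsDensity Measure.count (spike e i) where
  measurable := Measurable.of_discrete
  nonneg y := by
    rcases y with _ | j
    · simpa [spike] using he1
    · simp only [spike]
      split_ifs <;> simp [he0]
  lintegral_eq_one := by
    rw [lintegral_count, tsum_fintype, Fintype.sum_option]
    simp only [spike, apply_ite ENNReal.ofReal, ENNReal.ofReal_zero, Finset.sum_ite_eq',
      Finset.mem_univ, if_true]
    rw [← ENNReal.ofReal_add (by linarith) he0, sub_add_cancel, ENNReal.ofReal_one]

theorem integral_log_spike {e : ℝ} (he0 : 0 ≤ e) (he1 : e ≤ 1) (i : Fin M)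
    (q : Option (Fin M) → ℝ) :
    ∫ y, Real.log (spike e i y / q y) ∂law Measure.count (spike e i) =
      (1 - e) * Real.log ((1 - e) / q none) + e * Real.log (e / q (some i)) := by
  have := (isDensity_spike he0 he1 i).isProbabilityMeasure_law
  rw [integral_fintype Integrable.of_finite, Fintype.sum_option]
  simp only [Measure.real, law_count_singleton, smul_eq_mul,
    ENNReal.toReal_ofReal ((isDensity_spike he0 he1 i).nonneg _)]
  rw [Finset.sum_eq_single i (fun j _ hj => by simp [spike, hj]) (by simp)]
  simp [spike]

/-- Every density is at divergence at least `e log M` from one of the spikes. -/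
theorem exists_kl_spike_ge (hM : 0 < M) {e : ℝ} (he0 : 0 < e) (he1 : e < 1)
    {q : Option (Fin M) → ℝ} (hq : IsDensity Measure.count q) :
    ∃ i : Fin M, ENNReal.ofReal (e * Real.log M) ≤ kl Measure.count (spike e i) q := by
  have : Nonempty (Fin M) := ⟨⟨0, hM⟩⟩
  have hM0 : (0 : ℝ) < M := by exact_mod_cast hM
  obtain ⟨i, hi⟩ := Finite.exists_min fun i => q (some i)
  refine ⟨i, ?_⟩
  by_cases h0 : q none = 0
  · rw [kl_count_eq_top (y := none) (by simp only [spike]; linarith) h0]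
    exact le_top
  by_cases h1 : q (some i) = 0
  · rw [kl_count_eq_top (y := some i) (by simpa [spike] using he0) h1]
    exact le_top
  have h0' : 0 < q none := (hq.nonneg _).lt_of_ne' h0
  have h1' : 0 < q (some i) := (hq.nonneg _).lt_of_ne' h1
  have hsum : q none + ∑ j, q (some j) = 1 := by
    have h := hq.lintegral_eq_one
    rw [lintegral_count, tsum_fintype, ← ENNReal.ofReal_sum_of_nonneg fun y _ => hq.nonneg y,
      Fintype.sum_option, ENNReal.ofReal_eq_one] at h
    exact h
  have hmin : M * q (some i) ≤ 1 - q none := by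
    have h := Finset.card_nsmul_le_sum Finset.univ (fun j => q (some j)) (q (some i))
      fun j _ => hi j
    rw [Finset.card_univ, Fintype.card_fin, nsmul_eq_mul] at h
    linarith
  -- The size of this constant is irrelevant; it only makes `IsDensity.kl_eq` applicable.
  have hdom : ∀ y, spike e i y ≤ (1 / q none + 1 / q (some i)) * q y := by
    rintro (_ | j)
    · rw [add_mul, div_mul_cancel₀ _ h0]
      simp only [spike]
      have : 0 ≤ 1 / q (some i) * q none := by positivity
      linarith
    · by_cases hj : j = i
      · subst hj
        rw [add_mul, div_mul_cancel₀ _ h1]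
        simp only [spike, if_true]
        have : 0 ≤ 1 / q none * q (some j) := by positivity
        linarith
      · simp only [spike, if_neg hj]
        have := hq.nonneg (some j)
        positivity
  rw [(isDensity_spike he0.le he1.le i).kl_eq hq hdom, integral_log_spike he0.le he1.le]
  refine ENNReal.ofReal_le_ofReal ?_
  have hne : 0 < 1 - e := by linarith
  -- After `e log M` is extracted, `log x ≥ 1 - 1/x` bounds the rest below by `1 - q none - M q(some
  -- i)`, which is nonnegative by `hmin`.
  have l1 := Real.one_sub_inv_le_log_of_pos (div_pos hne h0')
  have l2 := Real.one_sub_inv_le_log_of_pos (x := e / (M * q (some i))) (by positivity)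
  have l3 : Real.log (e / q (some i)) = Real.log M + Real.log (e / (M * q (some i))) := by
    rw [← Real.log_mul (by positivity) (by positivity)]
    congr 1
    field_simp
  rw [inv_div] at l1 l2
  have m1 := mul_le_mul_of_nonneg_left l1 hne.le
  have m2 := mul_le_mul_of_nonneg_left l2 he0.le
  rw [mul_sub, mul_div_cancel₀ _ hne.ne'] at m1
  rw [mul_sub, mul_div_cancel₀ _ he0.ne'] at m2
  rw [l3]
  linarith

/-- The all-`none` sample has the same probability `(1 - e)^n > δ` under every spike. The index is
chosen against the density returned on that one sample. -/
theorem exists_sampleLaw_kl_spike_lt (hM : 0 < M) {n : ℕ} {e δ B : ℝ} (he0 : 0 < e)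
    (he1 : e < 1) (hδe : δ < (1 - e) ^ n) (hB0 : 0 ≤ B)
    (hB : B < e * Real.log M) {phat : (Fin n → Option (Fin M)) → Option (Fin M) → ℝ}
    (hphat : IsDensityEstimator Measure.count phat) :
    ∃ i : Fin M, sampleLaw Measure.count (spike e i) n
      {X | kl Measure.count (spike e i) (phat X) ≤ ENNReal.ofReal B} <
        ENNReal.ofReal (1 - δ) := by
  obtain ⟨i, hi⟩ := exists_kl_spike_ge hM he0 he1 (hphat.isDensity fun _ => none)
  refine ⟨i, ?_⟩
  have := (isDensity_spike he0.le he1.le i).isProbabilityMeasure_law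
  have : IsProbabilityMeasure (sampleLaw Measure.count (spike e i) n) := by
    rw [sampleLaw]; infer_instance
  have hsub : {X | kl Measure.count (spike e i) (phat X) ≤ ENNReal.ofReal B} ⊆
      {fun _ => none}ᶜ := by
    intro X hX hXe
    rw [Set.mem_singleton_iff] at hXe
    subst hXe
    exact ((ENNReal.ofReal_lt_ofReal_iff_of_nonneg hB0).2 hB).not_ge (hi.trans hX)
  have hpoint : sampleLaw Measure.count (spike e i) n {fun _ => none} =
      ENNReal.ofReal ((1 - e) ^ n) := by
    rw [sampleLaw, Measure.pi_singleton]
    simp only [law_count_singleton, spike, Finset.prod_const, Finset.card_univ,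
      Fintype.card_fin]
    rw [ENNReal.ofReal_pow (by linarith)]
  refine (measure_mono hsub).trans_lt ?_
  rw [prob_compl_eq_one_sub (measurableSet_singleton _), hpoint, ← ENNReal.ofReal_one,
    ← ENNReal.ofReal_sub _ (by positivity)]
  have hle : (1 - e) ^ n ≤ 1 := pow_le_one₀ (by linarith) (by linarith)
  exact (ENNReal.ofReal_lt_ofReal_iff (by linarith)).2 (by linarith)

end LowerBound

/-! ### Choice of the spike mass -/

section LowerBoundNumerics

theorem exists_spike_mass {M n : ℕ} {δ : ℝ} (hM : 2 ≤ M) (hn : 1 ≤ n) (hδ0 : 0 < δ)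
    (hδ : δ ≤ 1 / 2) : ∃ e : ℝ, 0 < e ∧ e < 1 ∧ δ < (1 - e) ^ n ∧
      1 / 1000 * min (75 * Real.log (2 * M) * Real.log (2 / δ) / n) (Real.log M) <
        e * Real.log M := by
  have hM' : (2 : ℝ) ≤ M := by exact_mod_cast hM
  have hn' : (1 : ℝ) ≤ n := by exact_mod_cast hn
  have hlo := Real.log_two_gt_d9
  set D := Real.log (1 / δ) with hD
  have hD2 : Real.log 2 ≤ D :=
    Real.log_le_log two_pos (by rw [le_div_iff₀ hδ0]; linarith)
  have hD0 : 0 < D := by linarith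
  have hl2 : Real.log 2 ≤ Real.log M := Real.log_le_log two_pos hM'
  have hl0 : 0 < Real.log M := by linarith
  have hL : Real.log (2 * M) ≤ 2 * Real.log M := by
    rw [Real.log_mul two_ne_zero (by linarith)]; linarith
  have hL' : Real.log (2 / δ) ≤ 2 * D := by
    rw [show 2 / δ = 2 * (1 / δ) by ring, Real.log_mul two_ne_zero (by positivity)]; linarith
  have hL0 : 0 ≤ Real.log (2 / δ) :=
    Real.log_nonneg (by rw [le_div_iff₀ hδ0]; linarith)
  -- For `e ≤ 1/2`, `log(1 - e) ≥ -2e`, so `3en ≤ D` leaves `n log(1 - e) > -D = log δ`.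
  refine ⟨min (D / (3 * n)) (1 / 2), by positivity, by
    exact (min_le_right _ _).trans_lt (by norm_num), ?_, ?_⟩
  · set e := min (D / (3 * n)) (1 / 2)
    have he2 : e ≤ 1 / 2 := min_le_right _ _
    have he0 : 0 < e := by positivity
    have heD : e * (3 * n) ≤ D := by
      rw [← le_div_iff₀ (by positivity)]; exact min_le_left _ _
    have h1 := Real.one_sub_inv_le_log_of_pos (x := 1 - e) (by linarith)
    have h2 : -(2 * e) ≤ 1 - (1 - e)⁻¹ := by
      have : (1 - e)⁻¹ ≤ 1 + 2 * e := by
        rw [inv_le_iff_one_le_mul₀ (by linarith)]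
        nlinarith
      linarith
    rw [← Real.log_lt_log_iff hδ0 (pow_pos (by linarith) n), Real.log_pow]
    have h3 : Real.log δ = -D := by rw [hD, one_div, Real.log_inv, neg_neg]
    have h4 : (n : ℝ) * (-(2 * e)) ≤ n * Real.log (1 - e) :=
      mul_le_mul_of_nonneg_left (h2.trans h1) (by linarith)
    have h5 : 0 < e * n := by positivity
    rw [h3]
    linarith
  · rw [min_mul_of_nonneg _ _ hl0.le, lt_min_iff]
    constructor
    -- Each of the two logarithms costs a factor `2`, and `75 · 4 / 1000 = 3/10 < 1/3`.
    · calc 1 / 1000 * min (75 * Real.log (2 * M) * Real.log (2 / δ) / n) (Real.log M)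
          ≤ 1 / 1000 * (75 * (2 * Real.log M) * (2 * D) / n) := by
            refine mul_le_mul_of_nonneg_left ((min_le_left _ _).trans ?_) (by norm_num)
            gcongr
        _ = 3 / 10 * (D / n * Real.log M) := by ring
        _ < 1 / 3 * (D / n * Real.log M) := by
            have : 0 < D / n * Real.log M := by positivity
            linarith
        _ = D / (3 * n) * Real.log M := by field_simp
    · have := min_le_right (75 * Real.log (2 * M) * Real.log (2 / δ) / n) (Real.log M)
      linarith

end LowerBoundNumerics

end ModelAggregation

end

open ModelAggregation in
theorem theorem1 :
    -- the upper bound, for an arbitrary dictionary of `M` densities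
    (∀ (𝒳 : Type*) [MeasurableSpace 𝒳] (μ : Measure 𝒳) (M n : ℕ) [NeZero n] (δ : ℝ)
        (p : Fin M → 𝒳 → ℝ),
        2 ≤ M → 0 < δ → δ < 1 → (∀ i, IsDensity μ (p i)) →
        IsDensityEstimator μ (aggregate (n := n) p δ) ∧
        ∀ pstar ∈ Set.range p,
          ENNReal.ofReal (1 - δ) ≤ sampleLaw μ pstar n
            {X | kl μ pstar (aggregate p δ X) ≤ ENNReal.ofReal
              (min (75 * Real.log (2 * M) * Real.log (2 / δ) / n) (Real.log M))}) ∧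
    -- its optimality up to a multiplicative constant
    (∃ c : ℝ, 0 < c ∧ ∀ (M n : ℕ) (δ : ℝ), 2 ≤ M → 1 ≤ n → 0 < δ → δ ≤ 1 / 2 →
      ∃ (𝒴 : Type) (_ : MeasurableSpace 𝒴) (ν : Measure 𝒴) (p : Fin M → 𝒴 → ℝ),
        (∀ i, IsDensity ν (p i)) ∧
        ∀ phat : (Fin n → 𝒴) → 𝒴 → ℝ, IsDensityEstimator ν phat →
          ∃ pstar ∈ Set.range p,
            sampleLaw ν pstar n
              {X | kl ν pstar (phat X) ≤ ENNReal.ofReal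
                (c * min (75 * Real.log (2 * M) * Real.log (2 / δ) / n) (Real.log M))}
              < ENNReal.ofReal (1 - δ)) := by
  refine ⟨fun 𝒳 _ μ M n _ δ p hM hδ0 hδ1 hp =>
    ⟨isDensityEstimator_aggregate hp hM hδ0 hδ1, ?_⟩, 1 / 1000, by norm_num,
    fun M n δ hM hn hδ0 hδ => ?_⟩
  · rintro _ ⟨i, rfl⟩
    exact sampleLaw_kl_aggregate_ge hp i hM hδ0 hδ1
  · obtain ⟨e, he0, he1, hδe, hB⟩ := exists_spike_mass hM hn hδ0 hδ
    let _ : MeasurableSpace (Option (Fin M)) := ⊤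
    have : DiscreteMeasurableSpace (Option (Fin M)) := ⟨fun _ => trivial⟩
    refine ⟨Option (Fin M), ⊤, Measure.count, spike e,
      fun i => isDensity_spike he0.le he1.le i, fun phat hphat => ?_⟩
    have hM' : (2 : ℝ) ≤ M := by exact_mod_cast hM
    have hB0 : 0 ≤ 1 / 1000 * min (75 * Real.log (2 * M) * Real.log (2 / δ) / n)
        (Real.log M) := by
      have h1 : 0 ≤ Real.log (2 * M) := Real.log_nonneg (by linarith)
      have h2 : 0 ≤ Real.log (2 / δ) := Real.log_nonneg (by rw [le_div_iff₀ hδ0]; linarith)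
      have h3 : 0 ≤ Real.log M := Real.log_nonneg (by linarith)
      positivity
    obtain ⟨i, hi⟩ := exists_sampleLaw_kl_spike_lt (by omega) he0 he1 hδe hB0 hB hphat
    exact ⟨_, ⟨i, rfl⟩, hi⟩
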